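/- Conventions. A function $f$ on an interval $I\subseteq\mathbb R$ is called complex analytic in $I$ if it is the restriction to $I$ of a function of a complex variable that is analytic at every point of $I$; $\rho_0\in(0,\infty]$ is then the distance from the origin to the nearest singularity of this extension, i.e. the radius of the largest open disc about $0$ to which $f$ extends analytically from a right neighbourhood of $0$ ($\rho_0=\infty$ if the extension is entire). The finite part $\operatorname{f.p.}\!\!\int_0^a h(x)\,dx$, $0<a<\infty$, is the limit $\lim_{\varepsilon\to0^+}C_\varepsilon$, where $\int_\varepsilon^a h(x)\,dx=C_\varepsilon+D_\varepsilon$, $C_\varepsilon$ converges as $\varepsilon\to0^+$ and $D_\varepsilon$ is a finite linear combination of powers $\varepsilon^{-p}$, $p>0$, and of $\ln\varepsilon$. For $a=\infty$, finite parts, principal values and integrals are defined as the limits for $a\to\infty$ of those over $[0,a]$. Theorem. Let $0<\nu<1$, let $0<a<\infty$, let $f$ be complex analytic in $[0,a]$, and let $0<\omega<\min(a,\rho_0)$. (i) If $f(0)\neq0$, then all the quantities below exist, the series converges, and $$\operatorname{PV}\!\!\int_0^a\frac{f(x)}{x^\nu(\omega-x)}\,dx=-\sum_{k=0}^\infty\omega^k\,\operatorname{f.p.}\!\!\int_0^a\frac{f(x)}{x^{\nu+k+1}}\,dx-\pi\cot(\pi\nu)\,\frac{f(\omega)}{\omega^\nu}.$$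 (ii) If $f$ has a zero of order $m\ge1$ at the origin, $f(x)=x^mg(x)$ with $g$ complex analytic in $[0,a]$ and $g(0)\neq0$, then all the quantities below exist, the integrals in the finite sum and the series converge, and $$\operatorname{PV}\!\!\int_0^a\frac{f(x)}{x^\nu(\omega-x)}\,dx=-\sum_{k=0}^{m-1}\omega^k\int_0^a x^{m-k-\nu-1}g(x)\,dx-\sum_{k=0}^\infty\omega^{k+m}\,\operatorname{f.p.}\!\!\int_0^a\frac{g(x)}{x^{k+\nu+1}}\,dx-\pi\cot(\pi\nu)\,\omega^{m-\nu}g(\omega).$$ (iii) Let $f$ be complex analytic in $[0,\infty)$ and $0<\omega<\rho_0$ (any $\omega>0$ if the extension of $f$ is entire). If $\operatorname{PV}\!\int_0^\infty\frac{f(x)}{x^\nu(\omega-x)}\,dx=\lim_{a\to\infty}\operatorname{PV}\!\int_0^a\frac{f(x)}{x^\nu(\omega-x)}\,dx$ exists, then (i) and (ii), with $[0,\infty)$ in place of $[0,a]$, hold for $a=\infty$ as well. -/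

import Mathlib

open Filter Topology MeasureTheory

/-- A function `f` of a real variable is complex analytic in the set `s ⊆ ℝ` (an interval) if it
is the restriction to `s` of a function of a complex variable that is analytic at every point
of `s`. -/
def ComplexAnalyticIn (f : ℝ → ℂ) (s : Set ℝ) : Prop :=
  ∃ F : ℂ → ℂ, AnalyticOnNhd ℂ F ((fun x : ℝ => (x : ℂ)) '' s) ∧ ∀ x ∈ s, F (x : ℂ) = f x

/-- The distance from the origin to the nearest singularity of the complex extension of `f`:
the radius of the largest open disc about `0` on which there is an analytic function that
coincides with `f` to the right of the origin. It is `⊤` if the extension is entire. -/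
noncomputable def singularityDist (f : ℝ → ℂ) : ENNReal :=
  sSup {r : ENNReal | ∃ G : ℂ → ℂ, AnalyticOnNhd ℂ G (Metric.eball 0 r) ∧
    ∀ᶠ x : ℝ in 𝓝[≥] 0, G (x : ℂ) = f x}

/-- The Cauchy principal value of `∫₀ᵃ h(x) dx`, with singular point `ω ∈ (0, a)`, exists and
equals `I`. -/
def HasPVIntegral (h : ℝ → ℂ) (a ω : ℝ) (I : ℂ) : Prop :=
  (∀ᶠ ε : ℝ in 𝓝[>] 0,
    IntervalIntegrable h volume 0 (ω - ε) ∧ IntervalIntegrable h volume (ω + ε) a) ∧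
  Tendsto (fun ε : ℝ => (∫ x in (0 : ℝ)..(ω - ε), h x) + ∫ x in (ω + ε)..a, h x)
    (𝓝[>] 0) (𝓝 I)

/-- The principal value of `∫₀^∞ h(x) dx`, with singular point `ω > 0`, exists as the limit for
`a → ∞` of the principal values over `[0, a]`, and equals `I`. -/
def HasPVIntegralTop (h : ℝ → ℂ) (ω : ℝ) (I : ℂ) : Prop :=
  ∃ P : ℝ → ℂ, (∀ a : ℝ, ω < a → HasPVIntegral h a ω (P a)) ∧ Tendsto P atTop (𝓝 I)

/-- `D ε` consists of diverging terms only: it is a finite linear combination of the diverging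
powers `ε ^ (-p)`, `p > 0`, and of `ln ε`. -/
def IsDivergingPart (D : ℝ → ℂ) : Prop :=
  ∃ (s : Finset ℝ) (c : ℝ → ℂ) (d : ℂ), (∀ p ∈ s, 0 < p) ∧
    ∀ ε : ℝ, 0 < ε → D ε = (∑ p ∈ s, c p * ((ε ^ (-p) : ℝ) : ℂ)) + d * ((Real.log ε : ℝ) : ℂ)

/-- The finite part of the (in general divergent) integral `∫₀ᵃ h(x) dx` exists and equals `I`:
`∫_ε^a h(x) dx = C ε + D ε`, where `D` is a diverging part and `C ε → I` as `ε → 0+`. -/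
def HasFinitePart (h : ℝ → ℂ) (a : ℝ) (I : ℂ) : Prop :=
  ∃ C D : ℝ → ℂ, IsDivergingPart D ∧
    (∀ ε : ℝ, 0 < ε → ε < a →
      IntervalIntegrable h volume ε a ∧ ∫ x in ε..a, h x = C ε + D ε) ∧
    Tendsto C (𝓝[>] 0) (𝓝 I)

/-- The finite part of `∫₀^∞ h(x) dx` exists, as the limit for `a → ∞` of the finite parts over
`[0, a]`, and equals `I`. -/
def HasFinitePartTop (h : ℝ → ℂ) (I : ℂ) : Prop :=
  ∃ P : ℝ → ℂ, (∀ a : ℝ, 0 < a → HasFinitePart h a (P a)) ∧ Tendsto P atTop (𝓝 I)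

/-- The integral `∫₀ᵃ h(x) dx` converges and equals `I`. -/
def HasIntegral (h : ℝ → ℂ) (a : ℝ) (I : ℂ) : Prop :=
  IntervalIntegrable h volume 0 a ∧ ∫ x in (0 : ℝ)..a, h x = I

/-- The improper integral `∫₀^∞ h(x) dx = lim_{a → ∞} ∫₀ᵃ h(x) dx` converges and equals `I`. -/
def HasIntegralTop (h : ℝ → ℂ) (I : ℂ) : Prop :=
  ∃ P : ℝ → ℂ, (∀ a : ℝ, 0 < a → HasIntegral h a (P a)) ∧ Tendsto P atTop (𝓝 I)

/-- A diverging part that has a limit has the limit `0`. -/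
theorem IsDivergingPart.eq_zero_of_tendsto {D : ℝ → ℂ} (hD : IsDivergingPart D) {L : ℂ}
    (hL : Tendsto D (𝓝[>] 0) (𝓝 L)) : L = 0 := by
  obtain ⟨s, c, d, hs, hDe⟩ := hD
  have hL' := hL.congr' (f₂ := fun ε : ℝ => (∑ p ∈ s, c p * ((ε ^ (-p) : ℝ) : ℂ)) +
    d * ((Real.log ε : ℝ) : ℂ)) (by
      filter_upwards [self_mem_nhdsWithin] with ε hε using hDe ε hε)
  clear hL hDe
  have toC : ∀ u : ℝ → ℝ, Tendsto u (𝓝[>] 0) (𝓝 0) →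
      Tendsto (fun ε : ℝ => ((u ε : ℝ) : ℂ)) (𝓝[>] 0) (𝓝 0) := by
    intro u hu
    have h2 := (Complex.continuous_ofReal.tendsto 0).comp hu
    rw [Complex.ofReal_zero] at h2
    exact h2
  have pow0 : ∀ r : ℝ, 0 < r → Tendsto (fun ε : ℝ => ((ε ^ r : ℝ) : ℂ)) (𝓝[>] 0) (𝓝 0) := by
    intro r hr
    have h1 : Tendsto (fun ε : ℝ => ε ^ r) (𝓝[>] 0) (𝓝 0) := by
      have := (Real.continuousAt_rpow_const 0 r (Or.inr hr.le)).tendsto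
      rw [Real.zero_rpow hr.ne'] at this
      exact this.mono_left nhdsWithin_le_nhds
    exact toC _ h1
  induction s using Finset.induction_on_max with
  | empty =>
    simp only [Finset.sum_empty, zero_add] at hL'
    have hinv : Tendsto (fun ε : ℝ => (((Real.log ε)⁻¹ : ℝ) : ℂ)) (𝓝[>] 0) (𝓝 0) :=
      toC _ (tendsto_inv_atBot_zero.comp Real.tendsto_log_nhdsGT_zero)
    have hm := hL'.mul hinv
    have hd : d = 0 := by
      rw [mul_zero] at hm
      refine tendsto_nhds_unique (f := fun _ : ℝ => d) (l := 𝓝[>] (0 : ℝ)) tendsto_const_nhds ?_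
      refine hm.congr' ?_
      filter_upwards [Ioo_mem_nhdsGT (zero_lt_one' ℝ)] with ε hε
      have h0 : ((Real.log ε : ℝ) : ℂ) ≠ 0 := by
        exact_mod_cast (Real.log_neg hε.1 hε.2).ne
      push_cast
      field_simp
    simp only [hd, zero_mul] at hL'
    exact tendsto_nhds_unique hL' tendsto_const_nhds
  | insert q s hq ih =>
    have hqs : q ∉ s := fun h => lt_irrefl _ (hq q h)
    have hq0 : 0 < q := hs q (Finset.mem_insert_self _ _)
    have hc : c q = 0 := by
      have hm := hL'.mul (pow0 q hq0)
      rw [mul_zero] at hm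
      have hlim : Tendsto (fun ε : ℝ => c q + ((∑ p ∈ s, c p * ((ε ^ (q - p) : ℝ) : ℂ)) +
          d * ((Real.log ε * ε ^ q : ℝ) : ℂ))) (𝓝[>] 0) (𝓝 (c q + (0 + d * 0))) := by
        refine tendsto_const_nhds.add (Tendsto.add ?_ (tendsto_const_nhds.mul ?_))
        · have hz : (0 : ℂ) = ∑ p ∈ s, (0 : ℂ) := by simp
          rw [hz]
          refine tendsto_finsetSum _ fun p hp => ?_
          simpa using (pow0 (q - p) (sub_pos.2 (hq p hp))).const_mul (c p)
        · exact toC _ (tendsto_log_mul_rpow_nhdsGT_zero hq0)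
      have := tendsto_nhds_unique (hlim.congr' ?_) hm
      · simpa using this
      · filter_upwards [self_mem_nhdsWithin] with ε hε
        have hε' : (0 : ℝ) < ε := hε
        have e1 : ∀ p : ℝ, ((ε ^ (q - p) : ℝ) : ℂ) = ((ε ^ (-p) : ℝ) : ℂ) * ((ε ^ q : ℝ) : ℂ) := by
          intro p
          rw [← Complex.ofReal_mul, ← Real.rpow_add hε']
          congr 2
          ring
        have e2 : ((ε ^ (-q) : ℝ) : ℂ) * ((ε ^ q : ℝ) : ℂ) = 1 := by
          rw [← e1 q]; simp
        rw [Finset.sum_insert hqs]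
        simp only [e1, add_mul, Finset.sum_mul, Complex.ofReal_mul, mul_assoc, e2, mul_one]
        ring
    refine ih (fun p hp => hs p (Finset.mem_insert_of_mem hp)) ?_
    simpa [Finset.sum_insert hqs, hc] using hL'

/-- The finite part is unique. -/
theorem HasFinitePart.unique {h : ℝ → ℂ} {a : ℝ} (ha : 0 < a) {I J : ℂ}
    (hI : HasFinitePart h a I) (hJ : HasFinitePart h a J) : I = J := by
  obtain ⟨C, D, ⟨s, c, d, hs, hD⟩, hint, hC⟩ := hI
  obtain ⟨C', D', ⟨s', c', d', hs', hD'⟩, hint', hC'⟩ := hJ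
  have key : IsDivergingPart (fun ε => D' ε - D ε) := by
    classical
    refine ⟨s ∪ s', fun p => (if p ∈ s' then c' p else 0) - (if p ∈ s then c p else 0), d' - d,
      fun p hp => (Finset.mem_union.1 hp).elim (hs p) (hs' p), fun ε hε => ?_⟩
    simp only [hD ε hε, hD' ε hε, sub_mul, Finset.sum_sub_distrib, ite_mul, zero_mul,
      Finset.sum_ite_mem, Finset.union_inter_cancel_left, Finset.union_inter_cancel_right]
    ring
  refine sub_eq_zero.1 (key.eq_zero_of_tendsto ((hC.sub hC').congr' ?_))
  filter_upwards [Ioo_mem_nhdsGT ha] with ε hε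
  have h1 := (hint ε hε.1 hε.2).2.symm.trans (hint' ε hε.1 hε.2).2
  linear_combination h1

/-!
Both cases concern `f(x) = x ^ m g(x)`, with `m = 0` and `g = f` if `f(0) ≠ 0`.
Since `x ^ m - ω ^ m` is divisible by `x - ω`, the factor
`x ^ m` only contributes the finite sum of convergent integrals (`hasPVIntegral_pow_mul`), so the
point is to expand the principal value of `g(x) / (x ^ ν (ω - x))`.

No double series is needed. Write `g(x) = g(ω) + (x - ω) h(x)`, where `h` is again continuous
on `[0, a]` and holomorphic in the same disc. The finite parts
`FP_k(g)` of `∫ g(x) x ^ (-ν - k - 1) dx` are then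
`FP_k(g) = g(ω) FP_k(1) + FP_{k-1}(h) - ω FP_k(h)`, so that in `∑ ω ^ k FP_k(g)` the contribution of
`h` telescopes to `∫ h(x) x ^ (-ν) dx`. The remainder `ω ^ k FP_k(h)` tends to zero because the
finite parts grow at most like `R ^ (-k)` if the Taylor series at the origin converges absolutely
at `R > ω` (`exists_hasFinitePart_le`). The principal value splits in the same way, which leaves
`g = 1`: the geometric series on both sides of `ω` gives two logarithmically divergent series whose
difference is the Mittag-Leffler series of the cotangent (`hasPVIntegral_kernel`).

For `a = ∞`, Abel's test shows that the convergence of the principal value at infinity entails that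
of all the other integrals; their tails beyond some `b > ω` are differences `ω U_{k+1} - U_k`, where
`U_k`, the integral of `f(x) x ^ (-ν - k) / (ω - x)` over `[b, ∞)`, is `O(b ^ (-k))`, and the series
of tails telescopes again (`exists_hasSum_tails`).
-/

/-! ### Calculus of finite parts and principal values -/

theorem isDivergingPart_zero : IsDivergingPart fun _ => 0 :=
  ⟨∅, 0, 0, by simp, by simp⟩

theorem isDivergingPart_rpow (c : ℂ) {p : ℝ} (hp : 0 < p) :
    IsDivergingPart fun ε => c * ((ε ^ (-p) : ℝ) : ℂ) :=
  ⟨{p}, fun _ => c, 0, by simpa using hp, by simp⟩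

theorem IsDivergingPart.add {D E : ℝ → ℂ} (hD : IsDivergingPart D) (hE : IsDivergingPart E) :
    IsDivergingPart fun ε => D ε + E ε := by
  classical
  obtain ⟨s, c, d, hs, hD⟩ := hD
  obtain ⟨s', c', d', hs', hE⟩ := hE
  refine ⟨s ∪ s', fun p => (if p ∈ s' then c' p else 0) + (if p ∈ s then c p else 0), d' + d,
    fun p hp => (Finset.mem_union.1 hp).elim (hs p) (hs' p), fun ε hε => ?_⟩
  simp only [hD ε hε, hE ε hε, add_mul, Finset.sum_add_distrib, ite_mul, zero_mul,
    Finset.sum_ite_mem, Finset.union_inter_cancel_left, Finset.union_inter_cancel_right]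
  ring

theorem IsDivergingPart.const_mul {D : ℝ → ℂ} (hD : IsDivergingPart D) (b : ℂ) :
    IsDivergingPart fun ε => b * D ε := by
  obtain ⟨s, c, d, hs, hD⟩ := hD
  refine ⟨s, fun p => b * c p, b * d, hs, fun ε hε => ?_⟩
  simp only [hD ε hε, mul_add, Finset.mul_sum, mul_assoc]

theorem IsDivergingPart.sum {ι : Type*} (s : Finset ι) {D : ι → ℝ → ℂ}
    (hD : ∀ i ∈ s, IsDivergingPart (D i)) : IsDivergingPart fun ε => ∑ i ∈ s, D i ε := by
  classical
  induction s using Finset.induction_on with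
  | empty => simpa using isDivergingPart_zero
  | insert i s hi ih =>
    simp only [Finset.sum_insert hi]
    exact (hD i (Finset.mem_insert_self _ _)).add
      (ih fun j hj => hD j (Finset.mem_insert_of_mem hj))

theorem HasFinitePart.of_tendsto {h D : ℝ → ℂ} {a : ℝ} {I : ℂ} (hD : IsDivergingPart D)
    (hint : ∀ ε : ℝ, 0 < ε → ε < a → IntervalIntegrable h volume ε a)
    (ht : Tendsto (fun ε => (∫ x in ε..a, h x) - D ε) (𝓝[>] 0) (𝓝 I)) : HasFinitePart h a I :=
  ⟨_, D, hD, fun ε h0 ha => ⟨hint ε h0 ha, (sub_add_cancel _ _).symm⟩, ht⟩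

theorem HasFinitePart.add {h k : ℝ → ℂ} {a : ℝ} {I J : ℂ} (hI : HasFinitePart h a I)
    (hJ : HasFinitePart k a J) : HasFinitePart (fun x => h x + k x) a (I + J) := by
  obtain ⟨C, D, hD, hint, hC⟩ := hI
  obtain ⟨C', D', hD', hint', hC'⟩ := hJ
  refine ⟨fun ε => C ε + C' ε, _, hD.add hD', fun ε h0 ha => ?_, hC.add hC'⟩
  obtain ⟨i1, e1⟩ := hint ε h0 ha
  obtain ⟨i2, e2⟩ := hint' ε h0 ha
  refine ⟨i1.add i2, ?_⟩
  rw [intervalIntegral.integral_add i1 i2, e1, e2]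
  ring

theorem HasFinitePart.const_mul {h : ℝ → ℂ} {a : ℝ} {I : ℂ} (hI : HasFinitePart h a I) (b : ℂ) :
    HasFinitePart (fun x => b * h x) a (b * I) := by
  obtain ⟨C, D, hD, hint, hC⟩ := hI
  refine ⟨fun ε => b * C ε, _, hD.const_mul b, fun ε h0 ha => ?_, hC.const_mul b⟩
  obtain ⟨i1, e1⟩ := hint ε h0 ha
  refine ⟨i1.const_mul b, ?_⟩
  rw [intervalIntegral.integral_const_mul, e1]
  ring

theorem intervalIntegrable_congr_Ioc {h k : ℝ → ℂ} {a b : ℝ} (hab : a ≤ b)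
    (hhk : Set.EqOn h k (Set.Ioc a b)) (hi : IntervalIntegrable h volume a b) :
    IntervalIntegrable k volume a b :=
  hi.congr (by rwa [Set.uIoc_of_le hab])

theorem integral_congr_Ioc {h k : ℝ → ℂ} {a b : ℝ} (hab : a ≤ b)
    (hhk : Set.EqOn h k (Set.Ioc a b)) : ∫ x in a..b, h x = ∫ x in a..b, k x :=
  intervalIntegral.integral_congr_ae (ae_of_all _ fun x hx => hhk (by rwa [Set.uIoc_of_le hab] at hx))

theorem HasFinitePart.congr {h k : ℝ → ℂ} {a : ℝ} {I : ℂ} (hI : HasFinitePart h a I)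
    (hhk : Set.EqOn h k (Set.Ioc 0 a)) : HasFinitePart k a I := by
  obtain ⟨C, D, hD, hint, hC⟩ := hI
  refine ⟨C, D, hD, fun ε h0 ha => ?_, hC⟩
  obtain ⟨i1, e1⟩ := hint ε h0 ha
  have he : Set.EqOn h k (Set.Ioc ε a) := hhk.mono (Set.Ioc_subset_Ioc_left h0.le)
  exact ⟨intervalIntegrable_congr_Ioc ha.le he i1, by rw [← integral_congr_Ioc ha.le he, e1]⟩

theorem tendsto_integral_lower {h : ℝ → ℂ} {a : ℝ} (ha : 0 < a)
    (hi : IntervalIntegrable h volume 0 a) :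
    Tendsto (fun ε => ∫ x in ε..a, h x) (𝓝[>] 0) (𝓝 (∫ x in (0 : ℝ)..a, h x)) := by
  have h1 := (intervalIntegral.continuousOn_primitive_interval_left
    (μ := volume) (f := h) (a := 0) (b := a) ((intervalIntegrable_iff_integrableOn_Icc_of_le ha.le).1 hi
      |>.mono_set (by rw [Set.uIcc_of_le ha.le]))) 0 (by simp)
  refine h1.mono_left ?_
  rw [Set.uIcc_of_le ha.le]
  exact nhdsWithin_le_of_mem (mem_of_superset (Ioo_mem_nhdsGT ha) Set.Ioo_subset_Icc_self)

/-- A convergent integral is its own finite part. -/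
theorem HasIntegral.hasFinitePart {h : ℝ → ℂ} {a : ℝ} {I : ℂ} (ha : 0 < a)
    (hI : HasIntegral h a I) : HasFinitePart h a I := by
  refine .of_tendsto isDivergingPart_zero (fun ε h0 h1 => hI.1.mono_set ?_) ?_
  · rw [Set.uIcc_of_le h1.le, Set.uIcc_of_le ha.le]
    exact Set.Icc_subset_Icc_left h0.le
  · simpa [hI.2] using tendsto_integral_lower ha hI.1

theorem intervalIntegrable_of_continuousOn_Ioi {h : ℝ → ℂ} (hc : ContinuousOn h (Set.Ioi 0))
    {a b : ℝ} (ha : 0 < a) (hb : 0 < b) : IntervalIntegrable h volume a b :=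
  (hc.mono fun _ hx => lt_of_lt_of_le (lt_min ha hb) hx.1).intervalIntegrable

/-- The upper limit of a finite part can be moved. -/
theorem HasFinitePart.change_endpoint {h : ℝ → ℂ} (hc : ContinuousOn h (Set.Ioi 0)) {a b : ℝ}
    (ha : 0 < a) (hb : 0 < b) {I : ℂ} (hI : HasFinitePart h a I) :
    HasFinitePart h b (I + ∫ x in a..b, h x) := by
  obtain ⟨C, D, hD, hint, hC⟩ := hI
  refine .of_tendsto hD (fun ε h0 _ => intervalIntegrable_of_continuousOn_Ioi hc h0 hb) ?_
  refine (hC.add_const (∫ x in a..b, h x)).congr' ?_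
  filter_upwards [Ioo_mem_nhdsGT ha] with ε hε
  rw [← intervalIntegral.integral_add_adjacent_intervals
    (intervalIntegrable_of_continuousOn_Ioi hc hε.1 ha)
    (intervalIntegrable_of_continuousOn_Ioi hc ha hb), (hint ε hε.1 hε.2).2]
  ring

theorem HasIntegral.change_endpoint {h : ℝ → ℂ} (hc : ContinuousOn h (Set.Ioi 0)) {a b : ℝ}
    (ha : 0 < a) (hb : 0 < b) {I : ℂ} (hI : HasIntegral h a I) :
    HasIntegral h b (I + ∫ x in a..b, h x) := by
  have hab := intervalIntegrable_of_continuousOn_Ioi hc ha hb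
  exact ⟨hI.1.trans hab, by rw [← intervalIntegral.integral_add_adjacent_intervals hI.1 hab, hI.2]⟩

theorem HasPVIntegral.const_mul {h : ℝ → ℂ} {a ω : ℝ} {I : ℂ} (hI : HasPVIntegral h a ω I)
    (b : ℂ) : HasPVIntegral (fun x => b * h x) a ω (b * I) := by
  refine ⟨hI.1.mono fun ε hε => ⟨hε.1.const_mul b, hε.2.const_mul b⟩, ?_⟩
  simpa only [intervalIntegral.integral_const_mul, mul_add] using hI.2.const_mul b

theorem HasPVIntegral.unique {h : ℝ → ℂ} {a ω : ℝ} {I J : ℂ} (hI : HasPVIntegral h a ω I)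
    (hJ : HasPVIntegral h a ω J) : I = J :=
  tendsto_nhds_unique hI.2 hJ.2

/-- Two functions that agree on `(0, a]` except at `ω` have the same principal value. -/
theorem HasPVIntegral.congr {h k : ℝ → ℂ} {a ω : ℝ} {I : ℂ} (hω : 0 < ω) (hωa : ω < a)
    (hI : HasPVIntegral h a ω I) (hhk : ∀ x ∈ Set.Ioc 0 a, x ≠ ω → h x = k x) :
    HasPVIntegral k a ω I := by
  have hev : ∀ᶠ ε : ℝ in 𝓝[>] 0, ε ∈ Set.Ioo 0 (min ω (a - ω)) :=
    Ioo_mem_nhdsGT (lt_min hω (sub_pos.2 hωa))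
  have key : ∀ ε ∈ Set.Ioo 0 (min ω (a - ω)), (0 ≤ ω - ε ∧ ω + ε ≤ a) ∧
      Set.EqOn h k (Set.Ioc 0 (ω - ε)) ∧ Set.EqOn h k (Set.Ioc (ω + ε) a) := by
    rintro ε ⟨h0, h1⟩
    have h2 := h1.trans_le (min_le_left _ _)
    have h3 := h1.trans_le (min_le_right _ _)
    refine ⟨⟨by linarith, by linarith⟩, fun x hx => hhk x ⟨hx.1, ?_⟩ ?_,
      fun x hx => hhk x ⟨?_, hx.2⟩ ?_⟩
    · linarith [hx.2]
    · exact (hx.2.trans_lt (by linarith)).ne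
    · linarith [hx.1]
    · exact (lt_of_le_of_lt (by linarith) hx.1).ne'
  refine ⟨?_, hI.2.congr' ?_⟩
  · filter_upwards [hI.1, hev] with ε hε h2
    obtain ⟨⟨k1, k2⟩, k3, k4⟩ := key ε h2
    exact ⟨intervalIntegrable_congr_Ioc k1 k3 hε.1, intervalIntegrable_congr_Ioc k2 k4 hε.2⟩
  · filter_upwards [hev] with ε h2
    obtain ⟨⟨k1, k2⟩, k3, k4⟩ := key ε h2
    rw [integral_congr_Ioc k1 k3, integral_congr_Ioc k2 k4]

/-- Adding an integrable function to the integrand adds its integral to the principal value. -/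
theorem HasPVIntegral.add_hasIntegral {h k : ℝ → ℂ} {a ω : ℝ} {I J : ℂ} (hω : 0 < ω)
    (hωa : ω < a) (hI : HasPVIntegral h a ω I) (hJ : HasIntegral k a J) :
    HasPVIntegral (fun x => h x + k x) a ω (I + J) := by
  have ha : 0 < a := hω.trans hωa
  have hev : ∀ᶠ ε : ℝ in 𝓝[>] 0, ε ∈ Set.Ioo 0 (min ω (a - ω)) :=
    Ioo_mem_nhdsGT (lt_min hω (sub_pos.2 hωa))
  have hki : ∀ u v : ℝ, 0 ≤ u → u ≤ a → 0 ≤ v → v ≤ a → IntervalIntegrable k volume u v :=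
    fun u v h1 h2 h3 h4 => hJ.1.mono_set (by
      rw [Set.uIcc_of_le ha.le]
      exact Set.uIcc_subset_Icc ⟨h1, h2⟩ ⟨h3, h4⟩)
  have hev2 : ∀ᶠ ε : ℝ in 𝓝[>] 0, IntervalIntegrable k volume 0 (ω - ε) ∧
      IntervalIntegrable k volume (ω - ε) (ω + ε) ∧ IntervalIntegrable k volume (ω + ε) a := by
    filter_upwards [hev] with ε ⟨h0, h1⟩
    have h2 := h1.trans_le (min_le_left _ _)
    have h3 := h1.trans_le (min_le_right _ _)
    refine ⟨hki _ _ ?_ ?_ ?_ ?_, hki _ _ ?_ ?_ ?_ ?_, hki _ _ ?_ ?_ ?_ ?_⟩ <;> linarith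
  have hprim : ContinuousAt (fun x => ∫ t in (0 : ℝ)..x, k t) ω := by
    have := intervalIntegral.continuousOn_primitive_interval'
      (μ := volume) (f := k) (a := 0) (b₁ := 0) (b₂ := a) hJ.1 (by simp)
    rw [Set.uIcc_of_le ha.le] at this
    exact this.continuousAt (Icc_mem_nhds hω hωa)
  have hid : Tendsto (fun ε : ℝ => ε) (𝓝[>] 0) (𝓝 0) := tendsto_id.mono_left nhdsWithin_le_nhds
  have hm : Tendsto (fun ε : ℝ => ω - ε) (𝓝[>] 0) (𝓝 ω) := by simpa using hid.const_sub ω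
  have hp : Tendsto (fun ε : ℝ => ω + ε) (𝓝[>] 0) (𝓝 ω) := by simpa using hid.const_add ω
  have hlim : Tendsto (fun ε : ℝ => (∫ x in (0 : ℝ)..(ω - ε), k x) + ∫ x in (ω + ε)..a, k x)
      (𝓝[>] 0) (𝓝 J) := by
    have h1 := ((hprim.tendsto.comp hm).sub (hprim.tendsto.comp hp)).add_const J
    rw [sub_self, zero_add] at h1
    refine h1.congr' ?_
    filter_upwards [hev2] with ε ⟨k1, k2, k3⟩
    simp only [Function.comp]
    rw [← hJ.2, ← intervalIntegral.integral_add_adjacent_intervals (k1.trans k2) k3]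
    ring
  refine ⟨?_, (hI.2.add hlim).congr' ?_⟩
  · filter_upwards [hI.1, hev2] with ε h1 h2
    exact ⟨h1.1.add h2.1, h1.2.add h2.2.2⟩
  · filter_upwards [hI.1, hev2] with ε h1 h2
    rw [intervalIntegral.integral_add h1.1 h2.1, intervalIntegral.integral_add h1.2 h2.2.2]
    ring

/-! ### The principal value of the kernel -/

theorem HasSum.of_eq {ι E : Type*} [AddCommMonoid E] [TopologicalSpace E] {f g : ι → E} {a b : E}
    (h : HasSum f a) (hfg : ∀ i, g i = f i) (hab : b = a) : HasSum g b := by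
  rw [hab, funext hfg]
  exact h

theorem hasSum_sub_succ {u : ℕ → ℝ} (hu : Antitone u) (h0 : Tendsto u atTop (𝓝 0)) :
    HasSum (fun n => u n - u (n + 1)) (u 0) := by
  rw [hasSum_iff_tendsto_nat_of_nonneg fun n => sub_nonneg.2 (hu n.le_succ)]
  simp only [Finset.sum_range_sub']
  simpa using h0.const_sub (u 0)

/-- The Mittag-Leffler expansion of the cotangent, with the terms paired as `n + 1 - ν`, `n + ν`. -/
theorem hasSum_neg_pi_mul_cot {ν : ℝ} (hν0 : 0 < ν) (hν1 : ν < 1) :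
    HasSum (fun n : ℕ => 1 / ((n : ℝ) + 1 - ν) - 1 / ((n : ℝ) + ν))
      (-(Real.pi * Real.cot (Real.pi * ν))) := by
  have hmem : (ν : ℂ) ∈ Complex.integerComplement := by
    rintro ⟨n, hn⟩
    have h : (n : ℝ) = ν := by exact_mod_cast hn
    rw [← h] at hν0 hν1
    have h1 : (0 : ℤ) < n := by exact_mod_cast hν0
    have h2 : n < (1 : ℤ) := by exact_mod_cast hν1
    omega
  have h1 : HasSum (fun n : ℕ => 1 / (ν - ((n : ℝ) + 1)) + 1 / (ν + ((n : ℝ) + 1)))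
      (Real.pi * Real.cot (Real.pi * ν) - 1 / ν) := by
    have h2 := (summable_cotTerm hmem).hasSum
    simp only [cotTerm] at h2
    rw [← cot_series_rep' hmem] at h2
    rw [← Complex.hasSum_ofReal]
    push_cast
    exact h2
  have h3 : HasSum (fun n : ℕ => 1 / ((n : ℝ) + ν) - 1 / (((n + 1 : ℕ) : ℝ) + ν)) (1 / ν) := by
    have := hasSum_sub_succ (u := fun n : ℕ => 1 / ((n : ℝ) + ν)) (fun m n hmn => by
      dsimp only; gcongr) (by
        simp only [one_div]
        exact (tendsto_atTop_add_const_right _ _ tendsto_natCast_atTop_atTop).inv_tendsto_atTop)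
    simpa using this
  refine ((h1.neg).sub h3).of_eq (fun n => ?_) ?_
  · have : ν - ((n : ℝ) + 1) = -((n : ℝ) + 1 - ν) := by ring
    rw [this, one_div_neg_eq_neg_one_div]
    push_cast
    ring
  · ring

/-- Bernoulli's inequality bounds the difference of two antiderivatives of powers on `[0, 1]` by
its value at `1`. -/
theorem rpow_div_sub_rpow_div_bound {p q s : ℝ} (hp : 0 < p) (hpq : p ≤ q) (hs0 : 0 < s)
    (hs1 : s ≤ 1) : 0 ≤ s ^ p / p - s ^ q / q ∧ s ^ p / p - s ^ q / q ≤ 1 / p - 1 / q := by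
  have hq := hp.trans_le hpq
  constructor
  · have h1 : s ^ q ≤ s ^ p := Real.rpow_le_rpow_of_exponent_ge hs0 hs1 hpq
    have : s ^ q / q ≤ s ^ p / p := by gcongr
    linarith
  · have h1 := one_add_mul_self_le_rpow_one_add (s := s ^ p - 1) (p := q / p)
      (by linarith [Real.rpow_pos_of_pos hs0 p]) (by rwa [le_div_iff₀ hp, one_mul])
    rw [add_sub_cancel, ← Real.rpow_mul hs0.le, mul_div_cancel₀ _ hp.ne'] at h1
    have h2 : (1 + q / p * (s ^ p - 1)) / q ≤ s ^ q / q := by gcongr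
    have h3 : (1 + q / p * (s ^ p - 1)) / q = 1 / q + s ^ p / p - 1 / p := by
      field_simp
      ring
    linarith

theorem abs_rpow_div_sub_rpow_div_le {p q s : ℝ} (hp : 0 < p) (hq : 0 < q) (hs0 : 0 < s)
    (hs1 : s ≤ 1) : |s ^ p / p - s ^ q / q| ≤ |1 / p - 1 / q| := by
  rcases le_total p q with h | h
  · obtain ⟨h1, h2⟩ := rpow_div_sub_rpow_div_bound hp h hs0 hs1
    exact abs_le_abs_of_nonneg h1 h2
  · obtain ⟨h1, h2⟩ := rpow_div_sub_rpow_div_bound hq h hs0 hs1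
    rw [abs_sub_comm, abs_sub_comm (1 / p)]
    exact abs_le_abs_of_nonneg h1 h2

theorem summable_rpow_div {p s : ℝ} (hp : 0 < p) (hs0 : 0 < s) (hs1 : s < 1) :
    Summable fun n : ℕ => s ^ ((n : ℝ) + p) / ((n : ℝ) + p) := by
  refine Summable.of_nonneg_of_le (fun n => by positivity) (fun n => ?_)
    ((summable_geometric_of_lt_one hs0.le hs1).mul_right (s ^ p / p))
  rw [Real.rpow_add hs0, Real.rpow_natCast, mul_div_assoc]
  gcongr
  linarith [(n.cast_nonneg : (0 : ℝ) ≤ n)]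

/-- The two logarithmically divergent series arising from the two sides of the singular point
combine, for a symmetric excision of radius `δ → 0`, to the cotangent. -/
theorem tendsto_tsum_sub_tsum_cot {ν : ℝ} (hν0 : 0 < ν) (hν1 : ν < 1) :
    Tendsto (fun δ : ℝ => (∑' n : ℕ, (1 - δ) ^ ((n : ℝ) + (1 - ν)) / ((n : ℝ) + (1 - ν))) -
      ∑' n : ℕ, (1 + δ)⁻¹ ^ ((n : ℝ) + ν) / ((n : ℝ) + ν)) (𝓝[>] 0)
      (𝓝 (-(Real.pi * Real.cot (Real.pi * ν)))) := by
  have hν' : 0 < 1 - ν := sub_pos.2 hν1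
  have hid : Tendsto (fun δ : ℝ => δ) (𝓝[>] 0) (𝓝 0) := tendsto_id.mono_left nhdsWithin_le_nhds
  have hcot := hasSum_neg_pi_mul_cot hν0 hν1
  have hs : Tendsto (fun δ : ℝ => 1 - δ) (𝓝[>] 0) (𝓝 1) := by simpa using hid.const_sub 1
  have hev : ∀ᶠ δ : ℝ in 𝓝[>] 0, δ ∈ Set.Ioo (0 : ℝ) 1 := Ioo_mem_nhdsGT one_pos
  have hpow : ∀ p : ℝ, Tendsto (fun δ : ℝ => (1 - δ) ^ p / p) (𝓝[>] 0) (𝓝 (1 / p)) := by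
    intro p
    have := hs.rpow_const (p := p) (Or.inl one_ne_zero)
    rw [Real.one_rpow] at this
    exact this.div_const p
  have hmain : Tendsto (fun δ : ℝ => ∑' n : ℕ, ((1 - δ) ^ ((n : ℝ) + (1 - ν)) /
      ((n : ℝ) + (1 - ν)) - (1 - δ) ^ ((n : ℝ) + ν) / ((n : ℝ) + ν))) (𝓝[>] 0)
      (𝓝 (-(Real.pi * Real.cot (Real.pi * ν)))) := by
    rw [← hcot.tsum_eq]
    simp only [add_sub_assoc]
    refine tendsto_tsum_of_dominated_convergence
      (bound := fun n : ℕ => |1 / ((n : ℝ) + (1 - ν)) - 1 / ((n : ℝ) + ν)|) ?_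
      (fun n => (hpow _).sub (hpow _)) ?_
    · have := hcot.summable.abs
      simpa only [add_sub_assoc] using this
    · filter_upwards [hev] with δ ⟨h0, h1⟩ n
      exact abs_rpow_div_sub_rpow_div_le (by positivity) (by positivity) (by linarith)
        (by linarith)
  -- replacing `(1 + δ)⁻¹` by `1 - δ` costs `O(δ)` only
  have hrem : Tendsto (fun δ : ℝ => ∑' n : ℕ, ((1 + δ)⁻¹ ^ ((n : ℝ) + ν) / ((n : ℝ) + ν) -
      (1 - δ) ^ ((n : ℝ) + ν) / ((n : ℝ) + ν))) (𝓝[>] 0) (𝓝 0) := by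
    have hb : Tendsto (fun δ : ℝ => (1 + 1 / ν) * (δ * (1 + δ))) (𝓝[>] 0) (𝓝 0) := by
      have := (hid.mul (hid.const_add 1)).const_mul (1 + 1 / ν)
      simpa using this
    refine squeeze_zero' ?_ ?_ hb
    · filter_upwards [hev] with δ ⟨h0, h1⟩
      refine tsum_nonneg fun n => sub_nonneg.2 ?_
      have : 1 - δ ≤ (1 + δ)⁻¹ := by
        rw [← one_div, le_div_iff₀ (by linarith)]
        nlinarith
      gcongr
    · filter_upwards [hev] with δ ⟨h0, h1⟩
      have ht0 : 0 < (1 + δ)⁻¹ := by positivity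
      have ht1 : (1 + δ)⁻¹ < 1 := inv_lt_one_of_one_lt₀ (by linarith)
      have hg := (hasSum_geometric_of_lt_one ht0.le ht1).mul_left ((1 + 1 / ν) * δ ^ 2)
      have hval : (1 + 1 / ν) * δ ^ 2 * (1 - (1 + δ)⁻¹)⁻¹ = (1 + 1 / ν) * (δ * (1 + δ)) := by
        have : 1 - (1 + δ)⁻¹ = δ / (1 + δ) := by field_simp; ring
        rw [this, inv_div]
        field_simp
      rw [hval] at hg
      refine hasSum_le (fun n => ?_)
        ((summable_rpow_div hν0 ht0 ht1).sub (summable_rpow_div hν0 (by linarith)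
          (by linarith))).hasSum hg
      set p : ℝ := (n : ℝ) + ν with hp
      have hp0 : 0 < p := by positivity
      have hpν : ν ≤ p := by linarith [(n.cast_nonneg : (0 : ℝ) ≤ n)]
      have hst : 1 - δ = (1 + δ)⁻¹ * (1 + -δ ^ 2) := by field_simp; ring
      have hδ2 : 0 < 1 + -δ ^ 2 := by nlinarith
      -- Bernoulli's inequality needs an exponent at least `1`, and `p` may be smaller
      have h2 : 1 - (p + 1) * δ ^ 2 ≤ (1 + -δ ^ 2) ^ p := by
        have h3 := one_add_mul_self_le_rpow_one_add (s := -δ ^ 2) (p := p + 1)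
          (by linarith) (by linarith)
        have h4 : (1 + -δ ^ 2) ^ (p + 1) ≤ (1 + -δ ^ 2) ^ p :=
          Real.rpow_le_rpow_of_exponent_ge hδ2 (by nlinarith) (by linarith)
        linarith
      have h5 : (1 + δ)⁻¹ ^ p ≤ (1 + δ)⁻¹ ^ n := by
        rw [← Real.rpow_natCast]
        exact Real.rpow_le_rpow_of_exponent_ge ht0 ht1.le (by linarith)
      have h6 : (p + 1) / p ≤ 1 + 1 / ν := by
        rw [add_div, div_self hp0.ne']
        gcongr
      rw [hst, Real.mul_rpow ht0.le hδ2.le]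
      calc _ = (1 + δ)⁻¹ ^ p * (1 - (1 + -δ ^ 2) ^ p) / p := by ring
        _ ≤ (1 + δ)⁻¹ ^ p * ((p + 1) * δ ^ 2) / p := by gcongr; linarith
        _ = (p + 1) / p * δ ^ 2 * (1 + δ)⁻¹ ^ p := by ring
        _ ≤ _ := by gcongr
  have := hmain.sub hrem
  rw [sub_zero] at this
  refine this.congr' ?_
  filter_upwards [hev] with δ ⟨h0, h1⟩
  have ht0 : 0 < (1 + δ)⁻¹ := by positivity
  have ht1 : (1 + δ)⁻¹ < 1 := inv_lt_one_of_one_lt₀ (by linarith)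
  have s1 := summable_rpow_div hν' (s := 1 - δ) (by linarith) (by linarith)
  have s2 := summable_rpow_div hν0 (s := 1 - δ) (by linarith) (by linarith)
  have s3 := summable_rpow_div hν0 ht0 ht1
  rw [s1.tsum_sub s2, s3.tsum_sub s2]
  ring

theorem intervalIntegrable_kernel_left {ν ω y : ℝ} (hν1 : ν < 1) (hy0 : 0 ≤ y)
    (hy : y < ω) : IntervalIntegrable (fun x : ℝ => (x ^ ν * (ω - x))⁻¹) volume 0 y := by
  have h1 : IntervalIntegrable (fun x : ℝ => x ^ (-ν)) volume 0 y :=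
    intervalIntegral.intervalIntegrable_rpow' (by linarith)
  have h2 := h1.mul_continuousOn (g := fun x => (ω - x)⁻¹) (by
    refine ContinuousOn.inv₀ (continuousOn_const.sub continuousOn_id) fun x hx => ?_
    rw [Set.uIcc_of_le hy0] at hx
    exact (sub_pos.2 (hx.2.trans_lt hy)).ne')
  refine h2.congr fun x hx => ?_
  rw [Set.uIoc_of_le hy0] at hx
  simp only [mul_inv, Real.rpow_neg hx.1.le]

theorem hasSum_integral_kernel_left {ν ω y : ℝ} (hν1 : ν < 1) (hy0 : 0 < y)
    (hy : y < ω) : HasSum (fun n : ℕ => ω ^ (-ν) * ((y / ω) ^ ((n : ℝ) + (1 - ν)) /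
      ((n : ℝ) + (1 - ν)))) (∫ x in (0 : ℝ)..y, (x ^ ν * (ω - x))⁻¹) := by
  have hω : 0 < ω := hy0.trans hy
  have hser : ∀ x ∈ Set.Ioc 0 y, HasSum (fun n : ℕ => (ω ^ (n + 1))⁻¹ * x ^ ((n : ℝ) - ν))
      (x ^ ν * (ω - x))⁻¹ := by
    intro x hx
    have hx1 : x < ω := hx.2.trans_lt hy
    have := (hasSum_geometric_of_lt_one (r := x / ω) (div_nonneg hx.1.le hω.le)
      ((div_lt_one hω).2 hx1)).mul_left (ω⁻¹ * (x ^ ν)⁻¹)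
    refine this.of_eq (fun n => ?_) ?_
    · rw [Real.rpow_sub hx.1, Real.rpow_natCast, div_pow, pow_succ]
      field_simp
    · have : ω - x = ω * (1 - x / ω) := by field_simp
      rw [this, mul_inv, mul_inv]
      ring
  have hI := intervalIntegral.hasSum_integral_of_dominated_convergence (μ := volume) (a := 0)
    (b := y) (F := fun (n : ℕ) x => (ω ^ (n + 1))⁻¹ * x ^ ((n : ℝ) - ν))
    (f := fun x => (x ^ ν * (ω - x))⁻¹)
    (fun n x => (ω ^ (n + 1))⁻¹ * x ^ ((n : ℝ) - ν)) (fun n => by fun_prop)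
    (fun n => ae_of_all _ fun x hx => ?_) (ae_of_all _ fun x hx => ?_) ?_
    (ae_of_all _ fun x hx => hser x (by rwa [Set.uIoc_of_le hy0.le] at hx))
  · refine hI.of_eq (fun n => ?_) rfl
    have hn : (-1 : ℝ) < (n : ℝ) - ν := by linarith [(n.cast_nonneg : (0 : ℝ) ≤ n)]
    rw [intervalIntegral.integral_const_mul, integral_rpow (Or.inl hn),
      Real.zero_rpow (by linarith), sub_zero, Real.div_rpow hy0.le hω.le]
    have e1 : (n : ℝ) - ν + 1 = n + (1 - ν) := by ring
    have e2 : ω ^ ((n : ℝ) + (1 - ν)) = ω ^ (n + 1) * ω ^ (-ν) := by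
      rw [← Real.rpow_natCast, ← Real.rpow_add hω]
      push_cast
      congr 1
      ring
    rw [e1, e2]
    have : ω ^ (-ν) ≠ 0 := (Real.rpow_pos_of_pos hω _).ne'
    field_simp
  · rw [Set.uIoc_of_le hy0.le] at hx
    rw [Real.norm_of_nonneg]
    have := hx.1
    positivity
  · exact (hser x (by rwa [Set.uIoc_of_le hy0.le] at hx)).summable
  · refine (intervalIntegrable_kernel_left hν1 hy0.le hy).congr fun x hx => ?_
    exact ((hser x (by rwa [Set.uIoc_of_le hy0.le] at hx)).tsum_eq).symm

theorem intervalIntegrable_kernel_right {ν ω z a : ℝ} (hω : 0 < ω) (hz : ω < z) (ha : z ≤ a) :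
    IntervalIntegrable (fun x : ℝ => (x ^ ν * (ω - x))⁻¹) volume z a := by
  refine ContinuousOn.intervalIntegrable fun x hx => ?_
  rw [Set.uIcc_of_le ha] at hx
  have h1 : ω < x := hz.trans_le hx.1
  have h2 : x ≠ 0 := (hω.trans h1).ne'
  have h3 : ω - x ≠ 0 := (sub_neg.2 h1).ne
  have h4 : x ^ ν ≠ 0 := (Real.rpow_pos_of_pos (hω.trans h1) _).ne'
  refine ContinuousAt.continuousWithinAt (ContinuousAt.inv₀ ?_ (mul_ne_zero h4 h3))
  exact (Real.continuousAt_rpow_const x ν (Or.inl h2)).mul (by fun_prop)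

theorem hasSum_integral_kernel_right {ν ω z a : ℝ} (hν0 : 0 < ν) (hω : 0 < ω) (hz : ω < z)
    (ha : z ≤ a) : HasSum (fun n : ℕ => ω ^ (-ν) * ((ω / a) ^ ((n : ℝ) + ν) / ((n : ℝ) + ν)) -
      ω ^ (-ν) * ((ω / z) ^ ((n : ℝ) + ν) / ((n : ℝ) + ν)))
      (∫ x in z..a, (x ^ ν * (ω - x))⁻¹) := by
  have hz0 : 0 < z := hω.trans hz
  have ha0 : 0 < a := hz0.trans_le ha
  have hser : ∀ x ∈ Set.Ioc z a, HasSum (fun n : ℕ => ω ^ n * x ^ (-((n : ℝ) + ν) - 1))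
      (-(x ^ ν * (ω - x))⁻¹) := by
    intro x hx
    have hx1 : ω < x := hz.trans hx.1
    have hx0 : 0 < x := hω.trans hx1
    have := (hasSum_geometric_of_lt_one (r := ω / x) (div_nonneg hω.le hx0.le)
      ((div_lt_one hx0).2 hx1)).mul_left (x⁻¹ * (x ^ ν)⁻¹)
    refine this.of_eq (fun n => ?_) ?_
    · rw [neg_add, sub_eq_add_neg, Real.rpow_add hx0, Real.rpow_add hx0, Real.rpow_neg hx0.le,
        Real.rpow_neg hx0.le, Real.rpow_natCast, div_pow, Real.rpow_neg_one]
      field_simp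
    · have : ω - x = -(x * (1 - ω / x)) := by field_simp; ring
      rw [this, mul_neg, inv_neg, neg_neg, mul_inv, mul_inv]
      ring
  have hI := intervalIntegral.hasSum_integral_of_dominated_convergence (μ := volume) (a := z)
    (b := a) (F := fun (n : ℕ) x => ω ^ n * x ^ (-((n : ℝ) + ν) - 1))
    (f := fun x => -(x ^ ν * (ω - x))⁻¹)
    (fun n x => ω ^ n * x ^ (-((n : ℝ) + ν) - 1)) (fun n => by fun_prop)
    (fun n => ae_of_all _ fun x hx => ?_) (ae_of_all _ fun x hx => ?_) ?_
    (ae_of_all _ fun x hx => hser x (by rwa [Set.uIoc_of_le ha] at hx))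
  · rw [intervalIntegral.integral_neg] at hI
    refine hI.neg.of_eq (fun n => ?_) ?_
    · have hn : (0 : ℝ) < n + ν := by positivity
      have hnot : (0 : ℝ) ∉ Set.uIcc z a := by
        rw [Set.uIcc_of_le ha]
        exact fun h => absurd h.1 (not_le.2 hz0)
      rw [intervalIntegral.integral_const_mul, integral_rpow (Or.inr ⟨by linarith, hnot⟩),
        sub_add_cancel, Real.div_rpow hω.le hz0.le, Real.div_rpow hω.le ha0.le,
        Real.rpow_neg hz0.le, Real.rpow_neg ha0.le, Real.rpow_add hω, Real.rpow_natCast,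
        Real.rpow_neg hω.le]
      have : ω ^ ν ≠ 0 := (Real.rpow_pos_of_pos hω _).ne'
      have : z ^ ((n : ℝ) + ν) ≠ 0 := (Real.rpow_pos_of_pos hz0 _).ne'
      have : a ^ ((n : ℝ) + ν) ≠ 0 := (Real.rpow_pos_of_pos ha0 _).ne'
      field_simp
    · rw [neg_neg]
  · rw [Set.uIoc_of_le ha] at hx
    have := hz0.trans hx.1
    rw [Real.norm_of_nonneg]
    positivity
  · exact (hser x (by rwa [Set.uIoc_of_le ha] at hx)).summable
  · refine (intervalIntegrable_kernel_right (ν := ν) hω hz ha).neg.congr fun x hx => ?_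
    exact ((hser x (by rwa [Set.uIoc_of_le ha] at hx)).tsum_eq).symm

/-- The case of a constant numerator. The series is the contribution of the endpoint `a`, and the
cotangent that of the singular point. -/
theorem hasPVIntegral_kernel {ν ω a : ℝ} (hν0 : 0 < ν) (hν1 : ν < 1) (hω : 0 < ω) (ha : ω < a) :
    HasPVIntegral (fun x : ℝ => (((x ^ ν * (ω - x))⁻¹ : ℝ) : ℂ)) a ω
      ((ω ^ (-ν) * (∑' n : ℕ, (ω / a) ^ ((n : ℝ) + ν) / ((n : ℝ) + ν)) -
        ω ^ (-ν) * (Real.pi * Real.cot (Real.pi * ν)) : ℝ) : ℂ) := by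
  have hev : ∀ᶠ ε : ℝ in 𝓝[>] 0, ε ∈ Set.Ioo 0 (min ω (a - ω)) :=
    Ioo_mem_nhdsGT (lt_min hω (sub_pos.2 ha))
  have ha0 : 0 < a := hω.trans ha
  have hev' : ∀ᶠ ε : ℝ in 𝓝[>] 0, 0 < ε ∧ ε < ω ∧ ω + ε < a := by
    filter_upwards [hev] with ε ⟨h0, h1⟩
    have h2 := h1.trans_le (min_le_left _ _)
    have h3 := h1.trans_le (min_le_right _ _)
    exact ⟨h0, h2, by linarith⟩
  refine ⟨?_, ?_⟩
  · filter_upwards [hev'] with ε ⟨h0, h1, h2⟩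
    have i1 : IntervalIntegrable (fun x : ℝ => (x ^ ν * (ω - x))⁻¹) volume 0 (ω - ε) :=
      intervalIntegrable_kernel_left hν1 (by linarith) (by linarith)
    have i2 : IntervalIntegrable (fun x : ℝ => (x ^ ν * (ω - x))⁻¹) volume (ω + ε) a :=
      intervalIntegrable_kernel_right hω (by linarith) h2.le
    exact ⟨⟨i1.1.ofReal, i1.2.ofReal⟩, ⟨i2.1.ofReal, i2.2.ofReal⟩⟩
  · have hscale : Tendsto (fun ε : ℝ => ε / ω) (𝓝[>] 0) (𝓝[>] 0) := by
      refine tendsto_nhdsWithin_iff.2 ⟨?_, ?_⟩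
      · have : Tendsto (fun ε : ℝ => ε / ω) (𝓝 0) (𝓝 (0 / ω)) := tendsto_id.div_const ω
        rw [zero_div] at this
        exact this.mono_left nhdsWithin_le_nhds
      · filter_upwards [self_mem_nhdsWithin] with ε hε using div_pos hε hω
    have hlim := (((tendsto_tsum_sub_tsum_cot hν0 hν1).comp hscale).const_mul (ω ^ (-ν))).const_add
      (ω ^ (-ν) * ∑' n : ℕ, (ω / a) ^ ((n : ℝ) + ν) / ((n : ℝ) + ν))
    have hlim2 := (Complex.continuous_ofReal.tendsto _).comp hlim
    rw [mul_neg, ← sub_eq_add_neg] at hlim2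
    refine hlim2.congr' ?_
    filter_upwards [hev'] with ε ⟨h0, h1, h2⟩
    have hL := hasSum_integral_kernel_left hν1 (y := ω - ε) (ω := ω) (by linarith) (by linarith)
    have hR := hasSum_integral_kernel_right hν0 hω (z := ω + ε) (by linarith) h2.le
    have e1 : (ω - ε) / ω = 1 - ε / ω := by rw [sub_div, div_self hω.ne']
    have e2 : ω / (ω + ε) = (1 + ε / ω)⁻¹ := by field_simp
    have hδ : 0 < ε / ω := div_pos h0 hω
    have s1 := (summable_rpow_div hν0 (s := ω / a) (by positivity)
      ((div_lt_one ha0).2 ha)).mul_left (ω ^ (-ν))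
    have s2 := (summable_rpow_div hν0 (s := (1 + ε / ω)⁻¹) (by positivity)
      (inv_lt_one_of_one_lt₀ (by linarith))).mul_left (ω ^ (-ν))
    rw [e1] at hL
    rw [e2] at hR
    rw [intervalIntegral.integral_ofReal, intervalIntegral.integral_ofReal, ← hL.tsum_eq,
      ← hR.tsum_eq, s1.tsum_sub s2, tsum_mul_left, tsum_mul_left, tsum_mul_left]
    simp only [Function.comp]
    push_cast
    ring

/-! ### Existence and growth of the finite parts -/

/-- On `[0, R]` the function `g` is the restriction of a function that is holomorphic on an open
disc about the origin of radius larger than `R`. -/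
def ExtendsToDisc (g : ℝ → ℂ) (R : ℝ) : Prop :=
  ∃ r > R, ∃ G : ℂ → ℂ, DifferentiableOn ℂ G (Metric.ball 0 r) ∧ ∀ x ∈ Set.Icc 0 R, G (x : ℂ) = g x

/-- The Taylor series converges absolutely up to and including the radius `R`, because the disc of
holomorphy is larger. -/
theorem ExtendsToDisc.exists_hasSum {g : ℝ → ℂ} {R : ℝ} (hR : 0 < R) (hg : ExtendsToDisc g R) :
    ∃ c : ℕ → ℂ, (Summable fun j => ‖c j‖ * R ^ j) ∧
      ∀ x ∈ Set.Icc 0 R, HasSum (fun j => c j * (x : ℂ) ^ j) (g x) := by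
  obtain ⟨r, hr, G, hG, hGg⟩ := hg
  obtain ⟨r', h1, h2⟩ := exists_between hr
  lift r' to NNReal using (hR.trans h1).le
  have hr0 : 0 < r' := by exact_mod_cast hR.trans h1
  have hps := (hG.mono (Metric.closedBall_subset_ball h2)).hasFPowerSeriesOnBall hr0
  set p := cauchyPowerSeries G 0 r'
  have hmem : ∀ x ∈ Set.Icc 0 R, (x : ℂ) ∈ Metric.eball (0 : ℂ) r' := by
    intro x hx
    rw [Metric.eball_coe, mem_ball_zero_iff, Complex.norm_of_nonneg hx.1]
    exact hx.2.trans_lt h1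
  refine ⟨p.coeff, ?_, fun x hx => ?_⟩
  · have := p.summable_norm_apply
      (Metric.eball_subset_eball hps.r_le (hmem R ⟨hR.le, le_rfl⟩))
    refine this.congr fun n => ?_
    rw [p.apply_eq_pow_smul_coeff, smul_eq_mul, norm_mul, norm_pow, Complex.norm_of_nonneg hR.le,
      mul_comm]
  · have := hps.hasSum (hmem x hx)
    rw [zero_add, hGg x hx] at this
    refine this.of_eq (fun n => ?_) rfl
    rw [p.apply_eq_pow_smul_coeff, smul_eq_mul, mul_comm]

/-- The exponents `n - ν` stay away from zero, so that no logarithm and no small divisor occurs. -/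
theorem min_le_abs_int_sub {ν : ℝ} (n : ℤ) : min ν (1 - ν) ≤ |(n : ℝ) - ν| := by
  rcases le_or_gt n 0 with h | h
  · have : (n : ℝ) ≤ 0 := by exact_mod_cast h
    exact (min_le_left _ _).trans ((by linarith : ν ≤ -((n : ℝ) - ν)).trans (neg_le_abs _))
  · have : (1 : ℝ) ≤ n := by exact_mod_cast h
    exact (min_le_right _ _).trans ((by linarith : 1 - ν ≤ (n : ℝ) - ν).trans (le_abs_self _))

theorem integral_ofReal_rpow {p u v : ℝ} (hu : 0 < u) (huv : u ≤ v) (hp : p ≠ 0) :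
    ∫ x in u..v, ((x ^ (p - 1) : ℝ) : ℂ) = ((v ^ p / p : ℝ) : ℂ) - ((u ^ p / p : ℝ) : ℂ) := by
  have hnot : (0 : ℝ) ∉ Set.uIcc u v := by
    rw [Set.uIcc_of_le huv]
    exact fun h => absurd h.1 (not_le.2 hu)
  rw [intervalIntegral.integral_ofReal,
    integral_rpow (Or.inr ⟨fun h => hp (by linarith), hnot⟩), sub_add_cancel, sub_div]
  push_cast
  ring

theorem continuousOn_ofReal_rpow (p : ℝ) :
    ContinuousOn (fun x : ℝ => ((x ^ p : ℝ) : ℂ)) (Set.Ioi 0) := by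
  intro x hx
  have h1 := Real.continuousAt_rpow_const x p (Or.inl (ne_of_gt hx))
  exact (Complex.continuous_ofReal.continuousAt.comp h1).continuousWithinAt

/-- Termwise integration of a power series against a power. -/
theorem hasSum_integral_powerSeries {g : ℝ → ℂ} {R : ℝ} {c : ℕ → ℂ}
    (hc : Summable fun j => ‖c j‖ * R ^ j)
    (hg : ∀ x ∈ Set.Icc 0 R, HasSum (fun j => c j * (x : ℂ) ^ j) (g x)) {q : ℝ}
    (hq : ∀ j : ℕ, (j : ℝ) + q ≠ 0) {ε : ℝ} (hε : 0 < ε) (hεR : ε ≤ R) :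
    HasSum (fun j : ℕ => c j * (((R ^ ((j : ℝ) + q) / ((j : ℝ) + q) : ℝ) : ℂ) -
      ((ε ^ ((j : ℝ) + q) / ((j : ℝ) + q) : ℝ) : ℂ)))
      (∫ x in ε..R, g x * ((x ^ (q - 1) : ℝ) : ℂ)) := by
  have hcont : ContinuousOn (fun x : ℝ => ((x ^ (q - 1) : ℝ) : ℂ)) (Set.Icc ε R) :=
    (continuousOn_ofReal_rpow _).mono fun x hx => hε.trans_le hx.1
  obtain ⟨M, hM⟩ := isCompact_Icc.exists_bound_of_continuousOn hcont
  have hI := intervalIntegral.hasSum_integral_of_dominated_convergence (μ := volume) (a := ε)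
    (b := R) (F := fun (j : ℕ) x => c j * (x : ℂ) ^ j * ((x ^ (q - 1) : ℝ) : ℂ))
    (f := fun x => g x * ((x ^ (q - 1) : ℝ) : ℂ)) (fun j _ => ‖c j‖ * R ^ j * M)
    (fun j => Measurable.aestronglyMeasurable (by fun_prop))
    (fun j => ae_of_all _ fun x hx => ?_) (ae_of_all _ fun x hx => hc.mul_right _)
    intervalIntegrable_const (ae_of_all _ fun x hx => ?_)
  · refine hI.of_eq (fun j => ?_) rfl
    rw [← integral_ofReal_rpow hε hεR (hq j), ← intervalIntegral.integral_const_mul]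
    refine integral_congr_Ioc hεR fun x hx => ?_
    have hx0 : 0 < x := hε.trans hx.1
    rw [add_sub_assoc, Real.rpow_add hx0, Real.rpow_natCast]
    push_cast
    ring
  · rw [Set.uIoc_of_le hεR] at hx
    have hx0 : 0 < x := hε.trans hx.1
    rw [norm_mul, norm_mul, norm_pow, Complex.norm_of_nonneg hx0.le]
    have hM0 := hM x ⟨hx.1.le, hx.2⟩
    have h2 : x ^ j ≤ R ^ j := by gcongr; exact hx.2
    have hR0 : 0 < R := hε.trans_le hεR
    gcongr
  · rw [Set.uIoc_of_le hεR] at hx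
    exact (hg x ⟨(hε.trans hx.1).le, hx.2⟩).mul_right _

/-- The finite parts of `∫₀ᵃ g(x) x ^ (-(ν + k)) dx` exist and are `O(R ^ (-k))` if the Taylor
series of `g` at the origin converges absolutely at `R`: the powers `ε ^ (j + 1 - k - ν)` with
`j < k` make up the diverging part, and the other ones tend to zero. -/
theorem exists_hasFinitePart_le {ν : ℝ} (hν0 : 0 < ν) (hν1 : ν < 1) {g : ℝ → ℂ} {a R : ℝ}
    (hR : 0 < R) (hRa : R < a) (hgc : ContinuousOn g (Set.Icc 0 a)) (hg : ExtendsToDisc g R) :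
    ∃ (FP : ℕ → ℂ) (B : ℝ), (∀ k : ℕ,
      HasFinitePart (fun x : ℝ => g x * ((x ^ (-(ν + k)) : ℝ) : ℂ)) a (FP k)) ∧
      ∀ k, ‖FP k‖ ≤ B * (R⁻¹) ^ k := by
  obtain ⟨c, hc, hcg⟩ := hg.exists_hasSum hR
  obtain ⟨M, hM⟩ := isCompact_Icc.exists_bound_of_continuousOn hgc
  have hM0 : 0 ≤ M := (norm_nonneg _).trans (hM 0 ⟨le_rfl, (hR.trans hRa).le⟩)
  set κ := min ν (1 - ν)
  have hκ : 0 < κ := lt_min hν0 (sub_pos.2 hν1)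
  have hqκ : ∀ k j : ℕ, κ ≤ |(j : ℝ) + (1 - ν - k)| := by
    intro k j
    have := min_le_abs_int_sub (ν := ν) ((j : ℤ) + 1 - k)
    push_cast at this
    convert this using 2
    ring
  have hq0 : ∀ k j : ℕ, (j : ℝ) + (1 - ν - k) ≠ 0 := fun k j h0 => by
    have := hqκ k j
    rw [h0, abs_zero] at this
    exact this.not_gt hκ
  set t : ℕ → ℝ → ℕ → ℂ := fun k ε j =>
    c j * ((ε ^ ((j : ℝ) + (1 - ν - k)) / ((j : ℝ) + (1 - ν - k)) : ℝ) : ℂ) with ht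
  have htb : ∀ k : ℕ, ∀ ε : ℝ, 0 < ε → ε ≤ R → ∀ j,
      ‖t k ε j‖ ≤ ‖c j‖ * R ^ j * (ε ^ (1 - ν - k) / κ) := by
    intro k ε h0 h1 j
    simp only [ht]
    rw [norm_mul, Complex.norm_real, Real.norm_eq_abs, abs_div,
      abs_of_pos (Real.rpow_pos_of_pos h0 _), Real.rpow_add h0, Real.rpow_natCast, mul_assoc,
      mul_div_assoc]
    have := hqκ k j
    gcongr
  have hts : ∀ k : ℕ, ∀ ε : ℝ, 0 < ε → ε ≤ R → Summable (t k ε) := fun k ε h0 h1 =>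
    Summable.of_norm_bounded (hc.mul_right _) (htb k ε h0 h1)
  have hcontR : ∀ k : ℕ, ∀ ε : ℝ, 0 < ε →
      ContinuousOn (fun x : ℝ => g x * ((x ^ (-(ν + k)) : ℝ) : ℂ)) (Set.Icc ε a) := fun k ε h0 =>
    (hgc.mono (Set.Icc_subset_Icc_left h0.le)).mul
      ((continuousOn_ofReal_rpow _).mono fun x hx => h0.trans_le hx.1)
  have hint : ∀ k : ℕ, ∀ ε b : ℝ, 0 < ε → ε ≤ b → b ≤ a →
      IntervalIntegrable (fun x : ℝ => g x * ((x ^ (-(ν + k)) : ℝ) : ℂ)) volume ε b :=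
    fun k ε b h0 h1 h2 => ((hcontR k ε h0).mono (by
      rw [Set.uIcc_of_le h1]; exact Set.Icc_subset_Icc_right h2)).intervalIntegrable
  refine ⟨fun k => (∑' j, t k R j) + ∫ x in R..a, g x * ((x ^ (-(ν + k)) : ℝ) : ℂ),
    (∑' j, ‖c j‖ * R ^ j) * (R ^ (1 - ν) / κ) + M * R ^ (-ν) * (a - R), fun k => ?_, fun k => ?_⟩
  · have hD : IsDivergingPart fun ε => ∑ j ∈ Finset.range k,
        (-c j / (((j : ℝ) + (1 - ν - k) : ℝ) : ℂ)) * ((ε ^ (-(-((j : ℝ) + (1 - ν - k)))) : ℝ) : ℂ) := by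
      refine IsDivergingPart.sum _ fun j hj => isDivergingPart_rpow _ ?_
      have : (j : ℝ) + 1 ≤ k := by exact_mod_cast Finset.mem_range.1 hj
      linarith
    refine .of_tendsto hD (fun ε h0 h1 => hint k ε a h0 h1.le le_rfl) ?_
    have htail : Tendsto (fun ε : ℝ => ∑' j, t k ε (j + k)) (𝓝[>] 0) (𝓝 0) := by
      rw [← tsum_zero (α := ℂ) (β := ℕ)]
      refine tendsto_tsum_of_dominated_convergence (bound := fun j => ‖t k R (j + k)‖)
        ((summable_nat_add_iff k).2 (hts k R hR le_rfl).norm) (fun j => ?_) ?_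
      · have hp : 0 < ((j + k : ℕ) : ℝ) + (1 - ν - k) := by
          push_cast
          linarith [(j.cast_nonneg : (0 : ℝ) ≤ j)]
        have h1 : Tendsto (fun ε : ℝ => ε ^ (((j + k : ℕ) : ℝ) + (1 - ν - k))) (𝓝[>] 0) (𝓝 0) := by
          have := (Real.continuousAt_rpow_const 0 _ (Or.inr hp.le)).tendsto
          rw [Real.zero_rpow hp.ne'] at this
          exact this.mono_left nhdsWithin_le_nhds
        have h2 := ((Complex.continuous_ofReal.tendsto _).comp
          (h1.div_const (((j + k : ℕ) : ℝ) + (1 - ν - k)))).const_mul (c (j + k))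
        rw [zero_div, Complex.ofReal_zero, mul_zero] at h2
        exact h2
      · filter_upwards [Ioo_mem_nhdsGT hR] with ε hε j
        have hp : 0 < ((j + k : ℕ) : ℝ) + (1 - ν - k) := by
          push_cast
          linarith [(j.cast_nonneg : (0 : ℝ) ≤ j)]
        simp only [ht]
        rw [norm_mul, norm_mul, Complex.norm_of_nonneg, Complex.norm_of_nonneg]
        · have h1 := Real.rpow_le_rpow hε.1.le hε.2.le hp.le
          gcongr
        · exact div_nonneg (Real.rpow_nonneg hR.le _) hp.le
        · exact div_nonneg (Real.rpow_nonneg hε.1.le _) hp.le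
    have hlim := htail.const_sub
      ((∑' j, t k R j) + ∫ x in R..a, g x * ((x ^ (-(ν + k)) : ℝ) : ℂ))
    rw [sub_zero] at hlim
    refine hlim.congr' ?_
    filter_upwards [Ioo_mem_nhdsGT hR] with ε ⟨h0, h1⟩
    have hsum := hasSum_integral_powerSeries hc hcg (hq0 k) h0 h1.le
    simp only [mul_sub] at hsum
    have e1 : (1 - ν - (k : ℝ)) - 1 = -(ν + k) := by ring
    rw [e1] at hsum
    have e2 := hsum.tsum_eq
    rw [(hts k R hR le_rfl).tsum_sub (hts k ε h0 h1.le)] at e2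
    rw [← intervalIntegral.integral_add_adjacent_intervals (hint k ε R h0 h1.le hRa.le)
      (hint k R a hR hRa.le le_rfl), ← e2, ← (hts k ε h0 h1.le).sum_add_tsum_nat_add k]
    have e3 : ∀ j, (-c j / (((j : ℝ) + (1 - ν - k) : ℝ) : ℂ)) *
        ((ε ^ (-(-((j : ℝ) + (1 - ν - k)))) : ℝ) : ℂ) = -t k ε j := by
      intro j
      simp only [ht]
      rw [neg_neg, Complex.ofReal_div]
      ring
    simp only [e3, Finset.sum_neg_distrib]
    ring
  · have h1 : ‖∑' j, t k R j‖ ≤ (∑' j, ‖c j‖ * R ^ j) * (R ^ (1 - ν - k) / κ) := by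
      rw [← tsum_mul_right]
      exact tsum_of_norm_bounded (hc.mul_right _).hasSum (htb k R hR le_rfl)
    have h2 : ‖∫ x in R..a, g x * ((x ^ (-(ν + k)) : ℝ) : ℂ)‖ ≤ M * R ^ (-(ν + k)) * |a - R| := by
      refine intervalIntegral.norm_integral_le_of_norm_le_const fun x hx => ?_
      rw [Set.uIoc_of_le hRa.le] at hx
      have hx0 : 0 < x := hR.trans hx.1
      rw [norm_mul, Complex.norm_of_nonneg (Real.rpow_nonneg hx0.le _)]
      have h3 := hM x ⟨hx0.le, hx.2⟩
      have h4 : x ^ (-(ν + k)) ≤ R ^ (-(ν + k)) :=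
        Real.rpow_le_rpow_of_nonpos hR hx.1.le (by
          linarith [(k.cast_nonneg : (0 : ℝ) ≤ k)])
      gcongr
    refine (norm_add_le _ _).trans ((add_le_add h1 h2).trans (le_of_eq ?_))
    rw [abs_of_pos (sub_pos.2 hRa), sub_eq_add_neg (1 - ν), neg_add, Real.rpow_add hR,
      Real.rpow_add hR, Real.rpow_neg hR.le (k : ℝ), Real.rpow_natCast, inv_pow]
    ring

/-! ### The expansion over a finite interval -/

/-- Dividing out the value at an interior point of `[0, R]` preserves the extension to the disc. -/
theorem ExtendsToDisc.dslope {g : ℝ → ℂ} {R ω : ℝ} (hω : 0 < ω) (hωR : ω < R)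
    (hg : ExtendsToDisc g R) :
    DifferentiableAt ℝ g ω ∧ ExtendsToDisc (dslope g ω) R := by
  obtain ⟨r, hr, G, hG, hGg⟩ := hg
  have hball : Metric.ball (0 : ℂ) r ∈ 𝓝 (ω : ℂ) := Metric.isOpen_ball.mem_nhds (by
    rw [mem_ball_zero_iff, Complex.norm_of_nonneg hω.le]
    exact hωR.trans hr)
  have hd : HasDerivAt g (deriv G ω) ω := by
    refine ((hG.differentiableAt hball).hasDerivAt.comp_ofReal).congr_of_eventuallyEq ?_
    filter_upwards [Icc_mem_nhds hω hωR] with x hx using (hGg x hx).symm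
  refine ⟨hd.differentiableAt, r, hr, _root_.dslope G ω,
    (Complex.differentiableOn_dslope hball).2 hG, fun x hx => ?_⟩
  rcases eq_or_ne x ω with rfl | hne
  · rw [dslope_same, dslope_same, hd.deriv]
  · rw [dslope_of_ne _ hne, dslope_of_ne _ (by exact_mod_cast hne), slope_def_module,
      slope_def_module, hGg x hx, hGg ω ⟨hω.le, hωR.le⟩, ← Complex.ofReal_sub,
      ← Complex.ofReal_inv, Complex.coe_smul]

theorem eq_add_sub_mul_dslope (g : ℝ → ℂ) (ω x : ℝ) :
    g x = g ω + ((x : ℂ) - ω) * dslope g ω x := by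
  have := sub_smul_dslope g ω x
  rw [Complex.real_smul, Complex.ofReal_sub] at this
  rw [this]
  ring

theorem hasFinitePart_rpow {ν a : ℝ} (hν0 : 0 < ν) (k : ℕ) :
    HasFinitePart (fun x : ℝ => ((x ^ (-(ν + k) - 1) : ℝ) : ℂ)) a
      ((a ^ (-(ν + k)) / (-(ν + k)) : ℝ) : ℂ) := by
  have hp : 0 < ν + k := by positivity
  refine ⟨fun _ => ((a ^ (-(ν + k)) / (-(ν + k)) : ℝ) : ℂ),
    _, isDivergingPart_rpow (1 / ((ν + k : ℝ) : ℂ)) hp, fun ε h0 h1 => ⟨?_, ?_⟩,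
    tendsto_const_nhds⟩
  · exact intervalIntegrable_of_continuousOn_Ioi (continuousOn_ofReal_rpow _) h0 (h0.trans h1)
  · rw [integral_ofReal_rpow h0 h1.le (neg_ne_zero.2 hp.ne'), div_neg, div_neg]
    push_cast
    ring

theorem hasIntegral_mul_rpow {g : ℝ → ℂ} {a p : ℝ} (ha : 0 < a) (hp : -1 < p)
    (hg : ContinuousOn g (Set.Icc 0 a)) :
    HasIntegral (fun x => ((x ^ p : ℝ) : ℂ) * g x) a
      (∫ x in (0 : ℝ)..a, ((x ^ p : ℝ) : ℂ) * g x) := by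
  refine ⟨IntervalIntegrable.mul_continuousOn (f := fun x : ℝ => ((x ^ p : ℝ) : ℂ)) ?_
    (by rwa [Set.uIcc_of_le ha.le]), rfl⟩
  have := intervalIntegral.intervalIntegrable_rpow' (a := 0) (b := a) hp
  exact ⟨this.1.ofReal, this.2.ofReal⟩

theorem HasIntegral.const_mul {h : ℝ → ℂ} {a : ℝ} {I : ℂ} (hI : HasIntegral h a I) (b : ℂ) :
    HasIntegral (fun x => b * h x) a (b * I) :=
  ⟨hI.1.const_mul b, by rw [intervalIntegral.integral_const_mul, hI.2]⟩

theorem HasIntegral.sum {ι : Type*} (s : Finset ι) {h : ι → ℝ → ℂ} {a : ℝ} {I : ι → ℂ}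
    (hI : ∀ i ∈ s, HasIntegral (h i) a (I i)) :
    HasIntegral (fun x => ∑ i ∈ s, h i x) a (∑ i ∈ s, I i) := by
  refine ⟨?_, ?_⟩
  · have := IntervalIntegrable.sum s fun i hi => (hI i hi).1
    simpa only [Finset.sum_fn] using this
  · rw [intervalIntegral.integral_finsetSum fun i hi => (hI i hi).1]
    exact Finset.sum_congr rfl fun i hi => (hI i hi).2

/-- The expansion of the principal value. With `g(x) = g(ω) + (x - ω) h(x)` the `k`-th finite part
of `g` is `g(ω)` times that of `1` plus `FP (k - 1) - ω FP k`, with the finite parts of `h`, so that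
the series telescopes and only the kernel is left to be integrated. -/
theorem hasPVIntegral_of_extendsToDisc {ν : ℝ} (hν0 : 0 < ν) (hν1 : ν < 1) {g : ℝ → ℂ}
    {a R ω : ℝ} (hω : 0 < ω) (hωR : ω < R) (hRa : R < a) (hgc : ContinuousOn g (Set.Icc 0 a))
    (hg : ExtendsToDisc g R) :
    ∃ (FP : ℕ → ℂ) (S : ℂ),
      (∀ k : ℕ, HasFinitePart (fun x : ℝ => g x * ((x ^ (-(ν + k) - 1) : ℝ) : ℂ)) a (FP k)) ∧
      HasSum (fun k : ℕ => (ω : ℂ) ^ k * FP k) S ∧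
      HasPVIntegral (fun x : ℝ => g x * (((x ^ ν * (ω - x))⁻¹ : ℝ) : ℂ)) a ω
        (-S - ((ω ^ (-ν) * (Real.pi * Real.cot (Real.pi * ν)) : ℝ) : ℂ) * g ω) := by
  have hR : 0 < R := hω.trans hωR
  have ha : 0 < a := hR.trans hRa
  have hωa := hωR.trans hRa
  obtain ⟨hgd, hh⟩ := hg.dslope hω hωR
  set h := dslope g ω
  have hhc : ContinuousOn h (Set.Icc 0 a) :=
    (continuousOn_dslope (Icc_mem_nhds hω hωa)).2 ⟨hgc, hgd⟩
  obtain ⟨FPh, B, hFPh, hB⟩ := exists_hasFinitePart_le hν0 hν1 hR hRa hhc hh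
  have hI : HasIntegral (fun x => ((x ^ (-ν) : ℝ) : ℂ) * h x) a _ :=
    hasIntegral_mul_rpow ha (by linarith) hhc
  have hFP0 : FPh 0 = ∫ x in (0 : ℝ)..a, ((x ^ (-ν) : ℝ) : ℂ) * h x :=
    (hFPh 0).unique ha ((hI.hasFinitePart ha).congr fun x _ => by simp [mul_comm])
  -- the telescoping series
  have hv : Summable fun k : ℕ => (ω : ℂ) ^ k * FPh k := by
    have hq : Summable fun k : ℕ => B * (ω / R) ^ k :=
      (summable_geometric_of_lt_one (by positivity) ((div_lt_one hR).2 hωR)).mul_left B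
    refine Summable.of_norm_bounded hq fun k => ?_
    rw [norm_mul, norm_pow, Complex.norm_of_nonneg hω.le, div_eq_mul_inv, mul_pow]
    calc _ ≤ ω ^ k * (B * R⁻¹ ^ k) := by gcongr; exact hB k
      _ = _ := by ring
  have htel : HasSum (fun k : ℕ => (ω : ℂ) ^ k * FPh k - (ω : ℂ) ^ (k + 1) * FPh (k + 1))
      (FPh 0) := by
    have := hv.hasSum.sub ((hasSum_nat_add_iff' 1).2 hv.hasSum)
    simpa using this
  have hker : HasSum (fun k : ℕ => (ω : ℂ) ^ k * ((a ^ (-(ν + k)) / (-(ν + k)) : ℝ) : ℂ))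
      (-((ω ^ (-ν) * (∑' n : ℕ, (ω / a) ^ ((n : ℝ) + ν) / ((n : ℝ) + ν)) : ℝ) : ℂ)) := by
    have h1 := ((summable_rpow_div hν0 (s := ω / a) (by positivity)
      ((div_lt_one ha).2 hωa)).hasSum.mul_left (ω ^ (-ν))).neg
    rw [← Complex.hasSum_ofReal] at h1
    refine h1.of_eq (fun k => ?_) (by push_cast; rfl)
    rw [← Complex.ofReal_pow, ← Complex.ofReal_mul]
    congr 1
    rw [div_neg, Real.div_rpow hω.le ha.le, Real.rpow_add hω, Real.rpow_natCast,
      Real.rpow_neg ha.le, Real.rpow_neg hω.le, add_comm ν]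
    have : ω ^ ν ≠ 0 := (Real.rpow_pos_of_pos hω _).ne'
    field_simp
  refine ⟨fun k => g ω * ((a ^ (-(ν + k)) / (-(ν + k)) : ℝ) : ℂ) + (FPh k + -ω * FPh (k + 1)), _,
    fun k => ?_, ((hker.mul_left (g ω)).add htel).of_eq (fun k => by ring) rfl, ?_⟩
  · refine (((hasFinitePart_rpow hν0 k).const_mul (g ω)).add
      ((hFPh k).add ((hFPh (k + 1)).const_mul (-ω)))).congr fun x hx => ?_
    have e1 : x ^ (-(ν + k)) = x * x ^ (-(ν + k) - 1) := by
      rw [Real.rpow_sub_one hx.1.ne', mul_div_cancel₀ _ hx.1.ne']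
    have e2 : -(ν + ((k + 1 : ℕ) : ℝ)) = -(ν + k) - 1 := by push_cast; ring
    simp only
    rw [e2, e1, eq_add_sub_mul_dslope g ω x]
    push_cast
    ring
  · have hpv := ((hasPVIntegral_kernel hν0 hν1 hω hωa).const_mul (g ω)).add_hasIntegral hω hωa
      (hI.const_mul (-1))
    rw [← hFP0] at hpv
    have hval := hpv.congr (k := fun x : ℝ => g x * (((x ^ ν * (ω - x))⁻¹ : ℝ) : ℂ)) hω hωa
      fun x hx hne => ?_
    · convert hval using 1
      push_cast
      ring
    · have h3 : ((ω : ℂ) - x) ≠ 0 := sub_ne_zero.2 (by exact_mod_cast hne.symm)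
      have h4 : ((x ^ ν : ℝ) : ℂ) ≠ 0 := by
        exact_mod_cast (Real.rpow_pos_of_pos hx.1 _).ne'
      rw [eq_add_sub_mul_dslope g ω x, Real.rpow_neg hx.1.le]
      push_cast
      field_simp
      ring

/-- The expansion of the principal value for a function with a factor `x ^ m`. -/
theorem hasPVIntegral_pow_mul {ν : ℝ} (hν0 : 0 < ν) (hν1 : ν < 1) {f g : ℝ → ℂ}
    {a R ω : ℝ} (hω : 0 < ω) (hωR : ω < R) (hRa : R < a) (hgc : ContinuousOn g (Set.Icc 0 a))
    (hg : ExtendsToDisc g R) (m : ℕ) (hf : ∀ x ∈ Set.Icc (0 : ℝ) a, f x = (x : ℂ) ^ m * g x) :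
    ∃ (J FP : ℕ → ℂ) (S : ℂ),
      (∀ k < m,
        HasIntegral (fun x : ℝ => ((x ^ ((m : ℝ) - k - ν - 1) : ℝ) : ℂ) * g x) a (J k)) ∧
      (∀ k : ℕ, HasFinitePart (fun x : ℝ => g x / ((x ^ (k + ν + 1) : ℝ) : ℂ)) a (FP k)) ∧
      HasSum (fun k : ℕ => (ω : ℂ) ^ (k + m) * FP k) S ∧
      HasPVIntegral (fun x : ℝ => f x / ((x ^ ν * (ω - x) : ℝ) : ℂ)) a ω
        (-(∑ k ∈ Finset.range m, (ω : ℂ) ^ k * J k) - S -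
          ((Real.pi * Real.cot (Real.pi * ν) * ω ^ ((m : ℝ) - ν) : ℝ) : ℂ) * g ω) := by
  have hωa := hωR.trans hRa
  have ha : 0 < a := hω.trans hωa
  obtain ⟨FP, S, hFP, hS, hPV⟩ := hasPVIntegral_of_extendsToDisc hν0 hν1 hω hωR hRa hgc hg
  have hJ : ∀ k < m, HasIntegral (fun x : ℝ => ((x ^ ((m : ℝ) - k - ν - 1) : ℝ) : ℂ) * g x) a
      (∫ x in (0 : ℝ)..a, ((x ^ ((m : ℝ) - k - ν - 1) : ℝ) : ℂ) * g x) := fun k hk =>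
    hasIntegral_mul_rpow ha (by
      have : (k : ℝ) + 1 ≤ m := by exact_mod_cast hk
      linarith) hgc
  refine ⟨_, FP, (ω : ℂ) ^ m * S, hJ, fun k => (hFP k).congr fun x hx => ?_,
    (hS.mul_left ((ω : ℂ) ^ m)).of_eq (fun k => by ring) rfl, ?_⟩
  · have : -(ν + k) - 1 = -((k : ℝ) + ν + 1) := by ring
    simp only
    rw [this, Real.rpow_neg hx.1.le, Complex.ofReal_inv, div_eq_mul_inv]
  · have hsum := (HasIntegral.sum (Finset.range m) fun k hk =>
      (hJ k (Finset.mem_range.1 hk)).const_mul ((ω : ℂ) ^ k)).const_mul (-1)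
    have hpv := ((hPV.const_mul ((ω : ℂ) ^ m)).add_hasIntegral hω hωa hsum).congr
      (k := fun x : ℝ => f x / ((x ^ ν * (ω - x) : ℝ) : ℂ)) hω hωa fun x hx hne => ?_
    · convert hpv using 1
      rw [Real.rpow_sub hω, Real.rpow_natCast, Real.rpow_neg hω.le]
      push_cast
      ring
    · have h3 : ((ω : ℂ) - x) ≠ 0 := sub_ne_zero.2 (by exact_mod_cast hne.symm)
      have h4 : ((x ^ ν : ℝ) : ℂ) ≠ 0 := by
        exact_mod_cast (Real.rpow_pos_of_pos hx.1 _).ne'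
      have hgeom := geom_sum₂_mul (ω : ℂ) (x : ℂ) m
      have hterm : ∑ k ∈ Finset.range m, (ω : ℂ) ^ k *
          (((x ^ ((m : ℝ) - k - ν - 1) : ℝ) : ℂ) * g x) =
          (∑ k ∈ Finset.range m, (ω : ℂ) ^ k * (x : ℂ) ^ (m - 1 - k)) *
            (g x * (((x ^ ν : ℝ) : ℂ))⁻¹) := by
        rw [Finset.sum_mul]
        refine Finset.sum_congr rfl fun k hk => ?_
        have hk' : k + 1 ≤ m := Finset.mem_range.1 hk
        have e1 : (m : ℝ) - k - ν - 1 = ((m - 1 - k : ℕ) : ℝ) + -ν := by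
          rw [Nat.sub_sub, Nat.cast_sub (by omega)]
          push_cast
          ring
        rw [e1, Real.rpow_add hx.1, Real.rpow_natCast, Real.rpow_neg hx.1.le]
        push_cast
        ring
      rw [hterm, hf x ⟨hx.1.le, hx.2⟩, eq_div_of_mul_eq h3 hgeom]
      push_cast
      field_simp
      ring

/-! ### The expansion over the half-line -/

theorem exists_norm_le_of_tendsto_atTop {Φ : ℝ → ℂ} {b : ℝ} {U : ℂ}
    (hc : ContinuousOn Φ (Set.Ici b)) (hU : Tendsto Φ atTop (𝓝 U)) :
    ∃ M, ∀ x, b ≤ x → ‖Φ x‖ ≤ M := by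
  obtain ⟨A, hA⟩ := eventually_atTop.1 (hU.norm.eventually (gt_mem_nhds (lt_add_one ‖U‖)))
  obtain ⟨M, hM⟩ := (isCompact_Icc (a := b) (b := A)).exists_bound_of_continuousOn
    (hc.mono Set.Icc_subset_Ici_self)
  refine ⟨max M (‖U‖ + 1), fun x hx => ?_⟩
  rcases le_total A x with h | h
  · exact (hA x h).le.trans (le_max_right _ _)
  · exact (hM x ⟨hx, h⟩).trans (le_max_left _ _)

/-- Abel's test: if `∫ φ` converges at infinity then so does `∫ φ(x) x ^ (-k)`, and it is
`O(b ^ (-k))`. Integration by parts moves the integration onto the bounded primitive of `φ`. -/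
theorem exists_tendsto_integral_mul_inv_pow {φ : ℝ → ℂ} {b : ℝ} (hb : 0 < b)
    (hφ : ContinuousOn φ (Set.Ici b)) {U₀ : ℂ}
    (hU₀ : Tendsto (fun A => ∫ x in b..A, φ x) atTop (𝓝 U₀)) :
    ∃ (U : ℕ → ℂ) (B : ℝ), U 0 = U₀ ∧ (∀ k : ℕ,
      Tendsto (fun A => ∫ x in b..A, φ x * ((x : ℂ) ^ k)⁻¹) atTop (𝓝 (U k))) ∧
      ∀ k, ‖U k‖ ≤ B * (b⁻¹) ^ k := by
  set Φ : ℝ → ℂ := fun A => ∫ x in b..A, φ x with hΦ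
  have hii : ∀ A, b ≤ A → IntervalIntegrable φ volume b A := fun A hA =>
    (hφ.mono (by rw [Set.uIcc_of_le hA]; exact Set.Icc_subset_Ici_self)).intervalIntegrable
  have hder : ∀ x, b < x → HasDerivAt Φ (φ x) x := fun x hx => by
    refine intervalIntegral.integral_hasDerivAt_right (hii x hx.le)
      (ContinuousOn.stronglyMeasurableAtFilter isOpen_Ioi (hφ.mono Set.Ioi_subset_Ici_self) x hx)
      (hφ.continuousAt (Ici_mem_nhds hx))
  have hΦc : ContinuousOn Φ (Set.Ici b) := by
    intro x hx
    have h1 := intervalIntegral.continuousOn_primitive_interval' (μ := volume) (f := φ)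
      (hii (x + 1) (by have : b ≤ x := hx; linarith)) (a := b) (by simp)
    rw [Set.uIcc_of_le (by have : b ≤ x := hx; linarith)] at h1
    refine (h1 x ⟨hx, by linarith⟩).mono_of_mem_nhdsWithin ?_
    rw [← Set.Ici_inter_Iic]
    exact inter_mem_nhdsWithin _ (Iic_mem_nhds (by linarith))
  obtain ⟨M, hM⟩ := exists_norm_le_of_tendsto_atTop hΦc hU₀
  have hM0 : 0 ≤ M := (norm_nonneg _).trans (hM b le_rfl)
  have key : ∀ k : ℕ, ∃ V : ℂ, (k = 0 → V = U₀) ∧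
      Tendsto (fun A => ∫ x in b..A, φ x * ((x : ℂ) ^ k)⁻¹) atTop (𝓝 V) ∧
      ‖V‖ ≤ (M + ‖U₀‖) * (b⁻¹) ^ k := by
    intro k
    rcases Nat.eq_zero_or_pos k with rfl | hk
    · refine ⟨U₀, fun _ => rfl, by simpa using hU₀, ?_⟩
      simpa using hM0
    have hk1 : (0 : ℝ) < k := by exact_mod_cast hk
    set v' : ℝ → ℂ := fun x => ((-k * x ^ (-(k : ℝ) - 1) : ℝ) : ℂ) with hv'
    have hv : ∀ x : ℝ, 0 < x → HasDerivAt (fun x : ℝ => ((x : ℂ) ^ k)⁻¹) (v' x) x := by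
      intro x hx
      have h1 := (Real.hasDerivAt_rpow_const (x := x) (p := -(k : ℝ)) (Or.inl hx.ne')).ofReal_comp
      refine h1.congr_of_eventuallyEq ?_
      filter_upwards [Ioi_mem_nhds hx] with y hy
      rw [Real.rpow_neg (le_of_lt hy), Real.rpow_natCast]
      push_cast
      rfl
    have hv'c : ContinuousOn v' (Set.Ioi 0) := by
      have := (continuousOn_ofReal_rpow (-(k : ℝ) - 1)).const_mul (-(k : ℂ))
      refine this.congr fun x _ => ?_
      simp only [hv']
      push_cast
      ring
    have hbound : ∀ x ∈ Set.Ioi b, ‖Φ x * v' x‖ ≤ M * k * x ^ (-(k : ℝ) - 1) := by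
      intro x hx
      have hx0 : 0 < x := hb.trans hx
      have := Real.rpow_nonneg hx0.le (-(k : ℝ) - 1)
      rw [norm_mul, Complex.norm_real, norm_mul, norm_neg, Real.norm_of_nonneg hk1.le,
        Real.norm_of_nonneg this, ← mul_assoc]
      have := hM x (le_of_lt hx)
      gcongr
    have hexp : -(k : ℝ) - 1 < -1 := by linarith
    have hbi : IntegrableOn (fun x : ℝ => M * k * x ^ (-(k : ℝ) - 1)) (Set.Ioi b) :=
      (integrableOn_Ioi_rpow_of_lt hexp hb).const_mul _
    have hint : IntegrableOn (fun x => Φ x * v' x) (Set.Ioi b) := by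
      refine Integrable.mono' hbi ?_ ((ae_restrict_iff' measurableSet_Ioi).2 (ae_of_all _ hbound))
      exact ((hΦc.mono Set.Ioi_subset_Ici_self).mul
        (hv'c.mono (Set.Ioi_subset_Ioi hb.le))).aestronglyMeasurable measurableSet_Ioi
    refine ⟨-∫ x in Set.Ioi b, Φ x * v' x, fun h => absurd h hk.ne', ?_, ?_⟩
    · have h1 := intervalIntegral_tendsto_integral_Ioi b hint tendsto_id
      have h2 : Tendsto (fun A : ℝ => ((A : ℂ) ^ k)⁻¹) atTop (𝓝 0) := by
        have h3 := (Complex.continuous_ofReal.tendsto 0).comp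
          ((tendsto_pow_atTop hk.ne').inv_tendsto_atTop (α := ℝ) (𝕜 := ℝ))
        rw [Complex.ofReal_zero] at h3
        refine h3.congr fun A => ?_
        simp
      have h4 := (hU₀.mul h2).sub h1
      rw [mul_zero, zero_sub] at h4
      refine h4.congr' ?_
      filter_upwards [eventually_ge_atTop b] with A hA
      have hsub : ∀ x ∈ Set.uIcc b A, 0 < x := fun x hx => by
        rw [Set.uIcc_of_le hA] at hx
        exact hb.trans_le hx.1
      have hvc : ContinuousOn (fun x : ℝ => ((x : ℂ) ^ k)⁻¹) (Set.uIcc b A) := fun x hx =>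
        (hv x (hsub x hx)).continuousAt.continuousWithinAt
      have hΦc' : ContinuousOn Φ (Set.uIcc b A) := hΦc.mono (by
        rw [Set.uIcc_of_le hA]; exact Set.Icc_subset_Ici_self)
      have hvi : IntervalIntegrable v' volume b A := (hv'c.mono hsub).intervalIntegrable
      have hparts := intervalIntegral.integral_deriv_mul_eq_sub_of_hasDerivAt hΦc' hvc
        (fun x hx => hder x (by rw [min_eq_left hA] at hx; exact hx.1))
        (fun x hx => hv x (by rw [min_eq_left hA] at hx; exact hb.trans hx.1)) (hii A hA) hvi
      rw [intervalIntegral.integral_add ((hii A hA).mul_continuousOn hvc)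
        (hvi.continuousOn_mul hΦc')] at hparts
      have hΦb : Φ b = 0 := by simp [hΦ]
      rw [hΦb, zero_mul, sub_zero] at hparts
      simp only [id]
      rw [← hparts]
      ring
    · rw [norm_neg]
      refine (norm_integral_le_of_norm_le hbi
        ((ae_restrict_iff' measurableSet_Ioi).2 (ae_of_all _ hbound))).trans ?_
      rw [integral_const_mul, integral_Ioi_rpow_of_lt hexp hb, sub_add_cancel, neg_div_neg_eq,
        Real.rpow_neg hb.le, Real.rpow_natCast, inv_pow, add_mul]
      have h5 : M * k * ((b ^ k)⁻¹ / k) = M * (b ^ k)⁻¹ := by field_simp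
      rw [h5]
      have : 0 ≤ ‖U₀‖ * (b ^ k)⁻¹ := by positivity
      linarith
  choose U hU using key
  exact ⟨U, M + ‖U₀‖, (hU 0).1 rfl, fun k => (hU k).2.1, fun k => (hU k).2.2⟩

/-- The tails beyond `b > ω` of the expansion: since
`x ^ (-k - 1) = (ω x ^ (-k - 1) - x ^ (-k)) / (ω - x)`, their series telescopes to the tail of the
principal value. -/
theorem exists_hasSum_tails {ν ω b : ℝ} (hω : 0 < ω) (hωb : ω < b) {f : ℝ → ℂ}
    (hf : ContinuousOn f (Set.Ici b)) {U₀ : ℂ}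
    (hU₀ : Tendsto (fun A => ∫ x in b..A, f x / ((x ^ ν * (ω - x) : ℝ) : ℂ)) atTop (𝓝 U₀)) :
    ∃ T : ℕ → ℂ, (∀ k : ℕ, Tendsto
      (fun A => ∫ x in b..A, f x * ((x ^ (-(ν + k) - 1) : ℝ) : ℂ)) atTop (𝓝 (T k))) ∧
      HasSum (fun k => (ω : ℂ) ^ k * T k) (-U₀) := by
  have hb : 0 < b := hω.trans hωb
  have hne : ∀ x ∈ Set.Ici b, x ^ ν * (ω - x) ≠ 0 := fun x hx => by
    have hx' : b ≤ x := hx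
    exact mul_ne_zero (Real.rpow_pos_of_pos (hb.trans_le hx') _).ne' (by linarith)
  have hφ : ContinuousOn (fun x : ℝ => f x / ((x ^ ν * (ω - x) : ℝ) : ℂ)) (Set.Ici b) := by
    refine hf.div (Complex.continuous_ofReal.comp_continuousOn
      (ContinuousOn.mul (fun x hx => ?_) (continuousOn_const.sub continuousOn_id)))
      fun x hx => by exact_mod_cast hne x hx
    exact (Real.continuousAt_rpow_const x ν
      (Or.inl (hb.trans_le hx).ne')).continuousWithinAt
  obtain ⟨U, B, hU0, hU, hB⟩ := exists_tendsto_integral_mul_inv_pow hb hφ hU₀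
  have hv : Summable fun k : ℕ => (ω : ℂ) ^ k * U k := by
    have hq : Summable fun k : ℕ => B * (ω / b) ^ k :=
      (summable_geometric_of_lt_one (by positivity) ((div_lt_one hb).2 hωb)).mul_left B
    refine Summable.of_norm_bounded hq fun k => ?_
    rw [norm_mul, norm_pow, Complex.norm_of_nonneg hω.le, div_eq_mul_inv, mul_pow]
    calc _ ≤ ω ^ k * (B * b⁻¹ ^ k) := by gcongr; exact hB k
      _ = _ := by ring
  have htel : HasSum (fun k : ℕ => (ω : ℂ) ^ k * U k - (ω : ℂ) ^ (k + 1) * U (k + 1)) U₀ := by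
    have := hv.hasSum.sub ((hasSum_nat_add_iff' 1).2 hv.hasSum)
    simpa [hU0] using this
  refine ⟨fun k => ω * U (k + 1) - U k, fun k => ?_,
    htel.neg.of_eq (fun k => by ring) rfl⟩
  refine (((hU (k + 1)).const_mul (ω : ℂ)).sub (hU k)).congr' ?_
  filter_upwards [eventually_ge_atTop b] with A hA
  have hii : ∀ k : ℕ, IntervalIntegrable
      (fun x : ℝ => f x / ((x ^ ν * (ω - x) : ℝ) : ℂ) * ((x : ℂ) ^ k)⁻¹) volume b A := by
    intro k
    refine ContinuousOn.intervalIntegrable ?_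
    rw [Set.uIcc_of_le hA]
    refine (hφ.mono Set.Icc_subset_Ici_self).mul (ContinuousOn.inv₀ (by fun_prop) fun x hx => ?_)
    exact pow_ne_zero _ (by exact_mod_cast (hb.trans_le hx.1).ne')
  rw [← intervalIntegral.integral_const_mul, ← intervalIntegral.integral_sub
    ((hii (k + 1)).const_mul _) (hii k)]
  refine integral_congr_Ioc hA fun x hx => ?_
  have hx0 : 0 < x := hb.trans hx.1
  have h1 : (x : ℂ) ≠ 0 := by exact_mod_cast hx0.ne'
  have h2 : ((x ^ ν : ℝ) : ℂ) ≠ 0 := by exact_mod_cast (Real.rpow_pos_of_pos hx0 _).ne'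
  have h3 : (ω : ℂ) - x ≠ 0 := sub_ne_zero.2 (by exact_mod_cast (hωb.trans hx.1).ne)
  have h4 : x ^ (-(ν + k) - 1) = (x ^ ν * x ^ (k + 1))⁻¹ := by
    rw [← Real.rpow_natCast, ← Real.rpow_add hx0, ← Real.rpow_neg hx0.le]
    push_cast
    congr 1
    ring
  rw [h4]
  push_cast
  field_simp
  ring

theorem HasPVIntegral.change_endpoint {h : ℝ → ℂ} {a b ω : ℝ} {I : ℂ}
    (hI : HasPVIntegral h a ω I) (hab : IntervalIntegrable h volume a b) :
    HasPVIntegral h b ω (I + ∫ x in a..b, h x) := by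
  refine ⟨hI.1.mono fun ε hε => ⟨hε.1, hε.2.trans hab⟩, ?_⟩
  refine (hI.2.add_const (∫ x in a..b, h x)).congr' ?_
  filter_upwards [hI.1] with ε hε
  rw [← intervalIntegral.integral_add_adjacent_intervals hε.2 hab]
  ring

/-- The expansion over the half-line: beyond some `b > ω` the tails of all the integrals add up. -/
theorem hasPVIntegralTop_pow_mul {ν : ℝ} (hν0 : 0 < ν) (hν1 : ν < 1) {f g : ℝ → ℂ}
    {R ω : ℝ} (hω : 0 < ω) (hωR : ω < R) (hgc : ContinuousOn g (Set.Ici 0))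
    (hg : ExtendsToDisc g R) (m : ℕ) (hf : ∀ x ∈ Set.Ici (0 : ℝ), f x = (x : ℂ) ^ m * g x)
    {L : ℂ} (hL : HasPVIntegralTop (fun x : ℝ => f x / ((x ^ ν * (ω - x) : ℝ) : ℂ)) ω L) :
    ∃ (J FP : ℕ → ℂ) (S : ℂ),
      (∀ k < m,
        HasIntegralTop (fun x : ℝ => ((x ^ ((m : ℝ) - k - ν - 1) : ℝ) : ℂ) * g x) (J k)) ∧
      (∀ k : ℕ, HasFinitePartTop (fun x : ℝ => g x / ((x ^ (k + ν + 1) : ℝ) : ℂ)) (FP k)) ∧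
      HasSum (fun k : ℕ => (ω : ℂ) ^ (k + m) * FP k) S ∧
      HasPVIntegralTop (fun x : ℝ => f x / ((x ^ ν * (ω - x) : ℝ) : ℂ)) ω
        (-(∑ k ∈ Finset.range m, (ω : ℂ) ^ k * J k) - S -
          ((Real.pi * Real.cot (Real.pi * ν) * ω ^ ((m : ℝ) - ν) : ℝ) : ℂ) * g ω) := by
  obtain ⟨b, hb⟩ := exists_gt R
  have hωb : ω < b := hωR.trans hb
  have hb0 : 0 < b := hω.trans hωb
  obtain ⟨J, FP, S, hJ, hFP, hS, hPV⟩ := hasPVIntegral_pow_mul hν0 hν1 hω hωR hb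
    (hgc.mono Set.Icc_subset_Ici_self) hg m fun x hx => hf x hx.1
  have hfc : ContinuousOn f (Set.Ici 0) := by
    have : ContinuousOn (fun x : ℝ => (x : ℂ) ^ m * g x) (Set.Ici 0) :=
      (Continuous.continuousOn (by fun_prop)).mul hgc
    exact this.congr hf
  obtain ⟨P, hP, hPL⟩ := hL
  have hU : Tendsto (fun A => ∫ x in b..A, f x / ((x ^ ν * (ω - x) : ℝ) : ℂ)) atTop
      (𝓝 (L - P b)) := by
    refine (hPL.sub_const (P b)).congr' ?_
    filter_upwards [eventually_ge_atTop b] with A hA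
    have hii : IntervalIntegrable (fun x : ℝ => f x / ((x ^ ν * (ω - x) : ℝ) : ℂ)) volume b A := by
      have := (intervalIntegrable_kernel_right (ν := ν) hω hωb hA)
      have h2 : IntervalIntegrable (fun x : ℝ => (((x ^ ν * (ω - x))⁻¹ : ℝ) : ℂ)) volume b A :=
        ⟨this.1.ofReal, this.2.ofReal⟩
      refine (h2.continuousOn_mul (hfc.mono fun x hx => ?_)).congr fun x _ => ?_
      · rw [Set.uIcc_of_le hA] at hx
        exact hb0.le.trans hx.1
      · simp only [Complex.ofReal_inv, div_eq_mul_inv]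
    rw [(hP A (hωb.trans_le hA)).unique ((hP b hωb).change_endpoint hii)]
    ring
  obtain ⟨T, hT, hTS⟩ := exists_hasSum_tails hω hωb (hfc.mono (Set.Ici_subset_Ici.2 hb0.le)) hU
  have hgc' : ContinuousOn g (Set.Ioi 0) := hgc.mono Set.Ioi_subset_Ici_self
  refine ⟨fun k => J k + T k, fun k => FP k + T (k + m), S + (-(L - P b) -
    ∑ k ∈ Finset.range m, (ω : ℂ) ^ k * T k), fun k hk => ?_, fun k => ?_, ?_, P, hP, ?_⟩
  · refine ⟨_, fun a ha => (hJ k hk).change_endpoint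
      ((continuousOn_ofReal_rpow _).mul hgc') hb0 ha, ?_⟩
    refine ((hT k).const_add (J k)).congr' ?_
    filter_upwards [eventually_ge_atTop b] with A hA
    congr 1
    refine integral_congr_Ioc hA fun x hx => ?_
    have hx0 : 0 < x := hb0.trans hx.1
    have h4 : (m : ℝ) - k - ν - 1 = m + (-(ν + k) - 1) := by ring
    rw [Pi.mul_apply, hf x hx0.le, h4, Real.rpow_add hx0, Real.rpow_natCast]
    push_cast
    ring
  · refine ⟨_, fun a ha => (hFP k).change_endpoint
      (hgc'.div (continuousOn_ofReal_rpow _) fun x hx => by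
        exact_mod_cast (Real.rpow_pos_of_pos hx _).ne') hb0 ha, ?_⟩
    refine ((hT (k + m)).const_add (FP k)).congr' ?_
    filter_upwards [eventually_ge_atTop b] with A hA
    congr 1
    refine integral_congr_Ioc hA fun x hx => ?_
    have hx0 : 0 < x := hb0.trans hx.1
    have hxm : x ^ m ≠ 0 := (pow_pos hx0 m).ne'
    have h4 : -(ν + ((k + m : ℕ) : ℝ)) - 1 = -((k : ℝ) + ν + 1) + -m := by push_cast; ring
    rw [Pi.div_apply, hf x hx0.le, h4, Real.rpow_add hx0, Real.rpow_neg hx0.le, Real.rpow_neg hx0.le,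
      Real.rpow_natCast]
    have hxm' : (x : ℂ) ^ m ≠ 0 := by exact_mod_cast hxm
    push_cast
    field_simp
  · exact (hS.add ((hasSum_nat_add_iff' m).2 hTS)).of_eq (fun k => by ring) rfl
  · convert hPL using 2
    have hPb := (hP b hωb).unique hPV
    simp only [mul_add, Finset.sum_add_distrib]
    linear_combination -hPb

/-! ### The distance to the nearest singularity -/

theorem ComplexAnalyticIn.continuousOn {g : ℝ → ℂ} {s : Set ℝ} (hg : ComplexAnalyticIn g s) :
    ContinuousOn g s := by
  obtain ⟨F, hF, hFg⟩ := hg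
  have : ContinuousOn (fun x : ℝ => F x) s :=
    hF.continuousOn.comp Complex.continuous_ofReal.continuousOn (Set.mapsTo_image _ _)
  exact this.congr fun x hx => (hFg x hx).symm

/-- If `f(x) = x ^ m g(x)`, the extension of `f` to the disc divided by `z ^ m` extends `g`; it
coincides with `g` on all of `[0, R]` by the identity theorem. -/
theorem exists_extendsToDisc_of_lt_singularityDist {f g : ℝ → ℂ} {s : Set ℝ} {b ω : ℝ}
    (hb : 0 < b) (hs : Set.Icc 0 b ⊆ s) (hg : ComplexAnalyticIn g s) {m : ℕ}
    (hf : ∀ x ∈ s, f x = (x : ℂ) ^ m * g x) (hω : ENNReal.ofReal ω < singularityDist f)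
    (hω0 : 0 < ω) (hωb : ω < b) : ∃ R, ω < R ∧ R < b ∧ ExtendsToDisc g R := by
  obtain ⟨r, ⟨G, hG, hGf⟩, hr⟩ := lt_sSup_iff.1 hω
  obtain ⟨ρ, h1, h2⟩ := ENNReal.lt_iff_exists_nnreal_btwn.1 hr
  have hωρ : ω < ρ := by
    rw [ENNReal.ofReal, ENNReal.coe_lt_coe] at h1
    exact (Real.toNNReal_lt_iff_lt_coe hω0.le).1 h1
  obtain ⟨R, hR1, hR2⟩ := exists_between (lt_min hωρ hωb)
  have hRρ := hR2.trans_le (min_le_left _ _)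
  have hRb := hR2.trans_le (min_le_right _ _)
  have hR0 : 0 < R := hω0.trans hR1
  have hρ0 : (0 : ℝ) < ρ := hR0.trans hRρ
  obtain ⟨H, hH, hHg⟩ := hg
  have hHan : ∀ x ∈ Set.Icc 0 b, AnalyticAt ℂ H (x : ℂ) := fun x hx =>
    hH _ (Set.mem_image_of_mem _ (hs hx))
  have hH0 : AnalyticAt ℂ H 0 := by
    simpa using hHan 0 ⟨le_rfl, hb.le⟩
  have hGan : ∀ z ∈ Metric.ball (0 : ℂ) ρ, AnalyticAt ℂ G z := fun z hz => hG z (by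
    rw [← Metric.eball_coe] at hz
    exact Metric.eball_subset_eball h2.le hz)
  have hG0 : AnalyticAt ℂ G 0 := hGan 0 (Metric.mem_ball_self hρ0)
  -- near the origin the two extensions differ by the factor `z ^ m` only
  have hGH : ∀ᶠ z in 𝓝 (0 : ℂ), G z = z ^ m * H z := by
    refine (hG0.frequently_eq_iff_eventually_eq ((analyticAt_id.pow m).mul hH0)).1 ?_
    have hreal : ∀ᶠ x : ℝ in 𝓝[>] 0, G (x : ℂ) = (x : ℂ) ^ m * H x := by
      filter_upwards [hGf.filter_mono (nhdsWithin_mono _ Set.Ioi_subset_Ici_self),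
        Ioo_mem_nhdsGT hb] with x hx hxb
      have hxs := hs ⟨hxb.1.le, hxb.2.le⟩
      rw [hx, hf x hxs, hHg x hxs]
    have hmap : Tendsto (fun x : ℝ => (x : ℂ)) (𝓝[>] 0) (𝓝[≠] 0) := by
      refine tendsto_nhdsWithin_iff.2 ⟨?_, ?_⟩
      · have := Complex.continuous_ofReal.tendsto 0
        rw [Complex.ofReal_zero] at this
        exact this.mono_left nhdsWithin_le_nhds
      · filter_upwards [self_mem_nhdsWithin] with x hx
        exact Complex.ofReal_ne_zero.2 (ne_of_gt hx)
    exact hmap.frequently hreal.frequently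
  classical
  set K : ℂ → ℂ := fun z => if z = 0 then H 0 else G z / z ^ m with hK
  have hKH : K =ᶠ[𝓝 0] H := by
    filter_upwards [hGH] with z hz
    by_cases h0 : z = 0
    · simp [hK, h0]
    · simp only [hK, if_neg h0]
      rw [hz, mul_div_cancel_left₀ _ (pow_ne_zero m h0)]
  have hKan : ∀ z ∈ Metric.ball (0 : ℂ) ρ, AnalyticAt ℂ K z := by
    intro z hz
    by_cases h0 : z = 0
    · rw [h0]
      exact hH0.congr hKH.symm
    · refine ((hGan z hz).div (analyticAt_id.pow m) (pow_ne_zero m h0)).congr ?_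
      filter_upwards [isOpen_ne.mem_nhds h0] with w hw
      simp only [hK, if_neg hw]
      rfl
  refine ⟨R, hR1, hRb, ρ, hRρ, K, fun z hz => (hKan z hz).differentiableAt.differentiableWithinAt,
    fun x hx => ?_⟩
  have hseg : Set.EqOn K H ((fun x : ℝ => (x : ℂ)) '' Set.Icc 0 R) := by
    refine AnalyticOnNhd.eqOn_of_preconnected_of_eventuallyEq (𝕜 := ℂ) (z₀ := 0) ?_ ?_
      (isPreconnected_Icc.image _ Complex.continuous_ofReal.continuousOn)
      ⟨0, ⟨le_rfl, hR0.le⟩, Complex.ofReal_zero⟩ hKH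
    · rintro _ ⟨x, hx, rfl⟩
      refine hKan _ ?_
      rw [mem_ball_zero_iff, Complex.norm_of_nonneg hx.1]
      exact hx.2.trans_lt hRρ
    · rintro _ ⟨x, hx, rfl⟩
      exact hHan x ⟨hx.1, hx.2.trans hRb.le⟩
  rw [hseg (Set.mem_image_of_mem _ hx), hHg x (hs ⟨hx.1, hx.2.trans hRb.le⟩)]

theorem theorem2 (ν : ℝ) (hν0 : 0 < ν) (hν1 : ν < 1) (f : ℝ → ℂ) :
    -- finite upper limit `a`
    (∀ a : ℝ, 0 < a → ComplexAnalyticIn f (Set.Icc 0 a) →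
      ∀ ω : ℝ, 0 < ω → ω < a → ENNReal.ofReal ω < singularityDist f →
        -- the case `f(0) ≠ 0`
        (f 0 ≠ 0 →
          ∃ (FP : ℕ → ℂ) (S : ℂ),
            (∀ k : ℕ,
              HasFinitePart (fun x : ℝ => f x / ((x ^ (ν + k + 1) : ℝ) : ℂ)) a (FP k)) ∧
            HasSum (fun k : ℕ => (ω : ℂ) ^ k * FP k) S ∧
            HasPVIntegral (fun x : ℝ => f x / ((x ^ ν * (ω - x) : ℝ) : ℂ)) a ω
              (-S - ((Real.pi * Real.cot (Real.pi * ν) : ℝ) : ℂ) *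
                (f ω / ((ω ^ ν : ℝ) : ℂ)))) ∧
        -- the case of a zero of order `m` at the origin, `f(x) = x ^ m * g(x)`
        (∀ (m : ℕ) (g : ℝ → ℂ), 1 ≤ m → ComplexAnalyticIn g (Set.Icc 0 a) → g 0 ≠ 0 →
          (∀ x ∈ Set.Icc (0 : ℝ) a, f x = (x : ℂ) ^ m * g x) →
          ∃ (J FP : ℕ → ℂ) (S : ℂ),
            (∀ k < m,
              HasIntegral (fun x : ℝ => ((x ^ ((m : ℝ) - k - ν - 1) : ℝ) : ℂ) * g x) a (J k)) ∧
            (∀ k : ℕ,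
              HasFinitePart (fun x : ℝ => g x / ((x ^ (k + ν + 1) : ℝ) : ℂ)) a (FP k)) ∧
            HasSum (fun k : ℕ => (ω : ℂ) ^ (k + m) * FP k) S ∧
            HasPVIntegral (fun x : ℝ => f x / ((x ^ ν * (ω - x) : ℝ) : ℂ)) a ω
              (-(∑ k ∈ Finset.range m, (ω : ℂ) ^ k * J k) - S -
                ((Real.pi * Real.cot (Real.pi * ν) * ω ^ ((m : ℝ) - ν) : ℝ) : ℂ) * g ω))) ∧
    -- `a = ∞`, whenever the principal value exists in the limit `a → ∞`
    (ComplexAnalyticIn f (Set.Ici 0) →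
      ∀ ω : ℝ, 0 < ω → ENNReal.ofReal ω < singularityDist f →
        (∃ L : ℂ, HasPVIntegralTop (fun x : ℝ => f x / ((x ^ ν * (ω - x) : ℝ) : ℂ)) ω L) →
        -- the case `f(0) ≠ 0`
        (f 0 ≠ 0 →
          ∃ (FP : ℕ → ℂ) (S : ℂ),
            (∀ k : ℕ,
              HasFinitePartTop (fun x : ℝ => f x / ((x ^ (ν + k + 1) : ℝ) : ℂ)) (FP k)) ∧
            HasSum (fun k : ℕ => (ω : ℂ) ^ k * FP k) S ∧
            HasPVIntegralTop (fun x : ℝ => f x / ((x ^ ν * (ω - x) : ℝ) : ℂ)) ω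
              (-S - ((Real.pi * Real.cot (Real.pi * ν) : ℝ) : ℂ) *
                (f ω / ((ω ^ ν : ℝ) : ℂ)))) ∧
        -- the case of a zero of order `m` at the origin, `f(x) = x ^ m * g(x)`
        (∀ (m : ℕ) (g : ℝ → ℂ), 1 ≤ m → ComplexAnalyticIn g (Set.Ici 0) → g 0 ≠ 0 →
          (∀ x ∈ Set.Ici (0 : ℝ), f x = (x : ℂ) ^ m * g x) →
          ∃ (J FP : ℕ → ℂ) (S : ℂ),
            (∀ k < m,
              HasIntegralTop (fun x : ℝ => ((x ^ ((m : ℝ) - k - ν - 1) : ℝ) : ℂ) * g x) (J k)) ∧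
            (∀ k : ℕ,
              HasFinitePartTop (fun x : ℝ => g x / ((x ^ (k + ν + 1) : ℝ) : ℂ)) (FP k)) ∧
            HasSum (fun k : ℕ => (ω : ℂ) ^ (k + m) * FP k) S ∧
            HasPVIntegralTop (fun x : ℝ => f x / ((x ^ ν * (ω - x) : ℝ) : ℂ)) ω
              (-(∑ k ∈ Finset.range m, (ω : ℂ) ^ k * J k) - S -
                ((Real.pi * Real.cot (Real.pi * ν) * ω ^ ((m : ℝ) - ν) : ℝ) : ℂ) * g ω))) := by
  have hval : ∀ (S : ℂ) (ω : ℝ), 0 < ω →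
      (-(∑ k ∈ Finset.range 0, (ω : ℂ) ^ k * (0 : ℂ)) - S -
        ((Real.pi * Real.cot (Real.pi * ν) * ω ^ (((0 : ℕ) : ℝ) - ν) : ℝ) : ℂ) * f ω) =
      -S - ((Real.pi * Real.cot (Real.pi * ν) : ℝ) : ℂ) * (f ω / ((ω ^ ν : ℝ) : ℂ)) := by
    intro S ω hω
    rw [Nat.cast_zero, zero_sub, Real.rpow_neg hω.le, Finset.sum_range_zero]
    push_cast
    ring
  have hf0 : ∀ s : Set ℝ, ∀ x ∈ s, f x = (x : ℂ) ^ 0 * f x := fun s x _ => by simp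
  have hexp : ∀ k : ℕ, (k : ℝ) + ν + 1 = ν + k + 1 := fun k => by ring
  refine ⟨fun a ha hfa ω hω hωa hωf => ⟨fun _ => ?_, fun m g _ hga _ hfg => ?_⟩,
    fun hfa ω hω hωf ⟨L, hL⟩ => ⟨fun _ => ?_, fun m g _ hga _ hfg => ?_⟩⟩
  · obtain ⟨R, h1, h2, h3⟩ := exists_extendsToDisc_of_lt_singularityDist ha subset_rfl hfa
      (hf0 _) hωf hω hωa
    obtain ⟨J, FP, S, -, hFP, hS, hPV⟩ := hasPVIntegral_pow_mul hν0 hν1 hω h1 h2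
      hfa.continuousOn h3 0 (hf0 _)
    refine ⟨FP, S, fun k => ?_, by simpa using hS, ?_⟩
    · simpa only [hexp] using hFP k
    · rw [← hval S ω hω]
      simpa only [Finset.sum_range_zero] using hPV
  · obtain ⟨R, h1, h2, h3⟩ := exists_extendsToDisc_of_lt_singularityDist ha subset_rfl hga
      hfg hωf hω hωa
    exact hasPVIntegral_pow_mul hν0 hν1 hω h1 h2 hga.continuousOn h3 m hfg
  · obtain ⟨R, h1, h2, h3⟩ := exists_extendsToDisc_of_lt_singularityDist
      (hω.trans (lt_add_one ω)) Set.Icc_subset_Ici_self hfa (hf0 _) hωf hω (lt_add_one ω)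
    obtain ⟨J, FP, S, -, hFP, hS, hPV⟩ := hasPVIntegralTop_pow_mul hν0 hν1 hω h1
      hfa.continuousOn h3 0 (hf0 _) hL
    refine ⟨FP, S, fun k => ?_, by simpa using hS, ?_⟩
    · simpa only [hexp] using hFP k
    · rw [← hval S ω hω]
      simpa only [Finset.sum_range_zero] using hPV
  · obtain ⟨R, h1, h2, h3⟩ := exists_extendsToDisc_of_lt_singularityDist
      (hω.trans (lt_add_one ω)) Set.Icc_subset_Ici_self hga hfg hωf hω (lt_add_one ω)
    exact hasPVIntegralTop_pow_mul hν0 hν1 hω h1 hga.continuousOn h3 m hfg hL
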